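/- Let $\mathcal S=[a,b]\subset\mathbb R$ with $a<b$ be a (one-dimensional) support set, and let $G_{\rm left}:\mathcal S\to\mathbb C^{n_{\rm left}\times m}$ and $G_{\rm right}:\mathcal S\to\mathbb C^{m\times n_{\rm right}}$ be continuously differentiable. Let $\mathbb M$ be the real vector space of square-integrable functions on $\mathcal S$ with values in the Hermitian $m\times m$ matrices, and let $\mathbf M\supset\mathbf M_+$ be the cones of those $\rho\in\mathbb M$ for which $\rho(\theta)$ is nonnegative definite, respectively positive definite, for every $\theta\in\mathcal S$. Put $L(\rho)=\int_{\mathcal S}G_{\rm left}(\theta)\rho(\theta)G_{\rm right}(\theta)\,d\theta$ for $\rho\in\mathbb M$, let $\mathfrak R=L(\mathbb M)$ be its range, a real linear space with inner product $\langle\lambda,R\rangle=\operatorname{Re}\operatorname{trace}(\lambda^*R)$ and norm $\|\cdot\|$, and let $\mathcal K=\overline{L(\mathbf M)}\subset\mathfrak R$, with ${\rm int}(\mathcal K)$ its interior in $\mathfrak R$. For $\lambda\in\mathfrak R$ let $L^*(\lambda)(\theta)=\frac12(M+M^*)$ with $M=G_{\rm left}(\theta)^*\lambda\,G_{\rm right}(\theta)^*$,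 and let $\mathcal K_+^{\rm dual}=\{\lambda\in\mathfrak R: L^*(\lambda)\in\mathbf M_+\}$. For $\lambda\in\mathcal K_+^{\rm dual}$ let $h(\lambda)=L(L^*(\lambda)^{-1})$ and let $$\nabla h|_\lambda:\mathfrak R\to\mathfrak R,\qquad \delta\mapsto -L\big(L^*(\lambda)^{-1}L^*(\delta)L^*(\lambda)^{-1}\big).$$ Assume that $\mathcal K_+^{\rm dual}\neq\emptyset$. (0) For $\lambda\in\mathcal K_+^{\rm dual}$ the map $\nabla h|_\lambda$ is the derivative of $h$ at $\lambda$ and is invertible, and for $R\in\mathfrak R$ the differential equation $$\frac{d\lambda_t}{dt}=(\nabla h|_{\lambda_t})^{-1}\big(R-L(L^*(\lambda_t)^{-1})\big)\qquad(*)$$ has at most one solution in $\mathcal K_+^{\rm dual}$ on any interval $[0,T)$ with a given initial value. (1) Let $R\in{\rm int}(\mathcal K)$. Then the functional $\rho\mapsto-\int_{\mathcal S}\operatorname{trace}(\log\rho(\theta))\,d\theta\in(-\infty,+\infty]$ has a minimizer on $\{\rho\in\mathbf M_+: L(\rho)=R\}$; it is unique up to equality almost everywhere, and it is $\rho=L^*(\hat\lambda)^{-1}$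 for some $\hat\lambda\in\mathcal K_+^{\rm dual}$. For every $\lambda_0\in\mathcal K_+^{\rm dual}$ the solution $\lambda_t$ of $(*)$ starting at $\lambda_0$ exists and belongs to $\mathcal K_+^{\rm dual}$ for all $t\in[0,\infty)$ and converges to $\hat\lambda$ as $t\to\infty$, and $V(\lambda_t)=\|R-L(L^*(\lambda_t)^{-1})\|^2$ satisfies $\frac{dV(\lambda_t)}{dt}=-2V(\lambda_t)$ for all $t\ge0$. (2) Let $R\in\mathfrak R$ with $R\notin{\rm int}(\mathcal K)$. Then $(*)$ diverges for every starting point $\lambda_0\in\mathcal K_+^{\rm dual}$: there is $T\in(0,\infty]$ such that the solution exists in $\mathcal K_+^{\rm dual}$ on $[0,T)$ and $\|\lambda_t\|\to\infty$ as $t\to T$. -/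

import Mathlib

open MeasureTheory Set Filter Topology
open scoped Matrix ComplexOrder

noncomputable section

/-- The Hermitian part `(M + Mᴴ) / 2` of a square complex matrix. -/
def hermPart {m : ℕ} (M : Matrix (Fin m) (Fin m) ℂ) : Matrix (Fin m) (Fin m) ℂ :=
  (2⁻¹ : ℝ) • (M + Mᴴ)

/-- The real inner product `⟨A, B⟩ = Re trace (Aᴴ B)` on rectangular complex matrices. -/
def reInner {p q : ℕ} (A B : Matrix (Fin p) (Fin q) ℂ) : ℝ := ((Aᴴ * B).trace).re

/-- The data of a matricial moment problem over a one-dimensional support: a nondegenerate compact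
interval `S = [a, b]` and continuously differentiable integration kernels `Gl` and `Gr` on it. -/
structure MomentKernel (m nl nr : ℕ) where
  a : ℝ
  b : ℝ
  a_lt_b : a < b
  Gl : ℝ → Matrix (Fin nl) (Fin m) ℂ
  Gr : ℝ → Matrix (Fin m) (Fin nr) ℂ
  contDiffOn_Gl : ∀ i j, ContDiffOn ℝ 1 (fun θ => Gl θ i j) (Icc a b)
  contDiffOn_Gr : ∀ i j, ContDiffOn ℝ 1 (fun θ => Gr θ i j) (Icc a b)

namespace MomentKernel

variable {m nl nr : ℕ} (D : MomentKernel m nl nr)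

/-- The support set. -/
def S : Set ℝ := Icc D.a D.b

instance : IsFiniteMeasure (volume.restrict D.S) :=
  inferInstanceAs (IsFiniteMeasure (volume.restrict (Icc D.a D.b)))

/-- The real vector space of square integrable functions on `S` with Hermitian matrix values
(actual functions, not classes; only their values on `S` matter). -/
def HermL2 : Submodule ℝ (ℝ → Matrix (Fin m) (Fin m) ℂ) where
  carrier := {f | (∀ θ ∈ D.S, (f θ).IsHermitian) ∧
    ∀ i j, MemLp (fun θ => f θ i j) 2 (volume.restrict D.S)}
  zero_mem' := ⟨fun _ _ => Matrix.isHermitian_zero, fun _ _ => MemLp.zero⟩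
  add_mem' := fun hf hg =>
    ⟨fun θ hθ => (hf.1 θ hθ).add (hg.1 θ hθ), fun i j => (hf.2 i j).add (hg.2 i j)⟩
  smul_mem' := fun c f hf =>
    ⟨fun θ hθ => by
      have h := hf.1 θ hθ
      simp only [Matrix.IsHermitian, Pi.smul_apply, Matrix.conjTranspose_smul, star_trivial] at h ⊢
      rw [h],
     fun i j => (hf.2 i j).const_smul c⟩

theorem continuousOn_Gl : ContinuousOn D.Gl D.S :=
  continuousOn_pi.2 fun i => continuousOn_pi.2 fun j => (D.contDiffOn_Gl i j).continuousOn

theorem continuousOn_Gr : ContinuousOn D.Gr D.S :=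
  continuousOn_pi.2 fun i => continuousOn_pi.2 fun j => (D.contDiffOn_Gr i j).continuousOn

/-- Continuous functions on `S` with Hermitian values are square integrable. -/
theorem mem_HermL2 {f : ℝ → Matrix (Fin m) (Fin m) ℂ} (hf : ContinuousOn f D.S)
    (hH : ∀ θ ∈ D.S, (f θ).IsHermitian) : f ∈ D.HermL2 := by
  refine ⟨hH, fun i j => ?_⟩
  have hc : ContinuousOn (fun θ => f θ i j) D.S :=
    continuousOn_pi.1 (continuousOn_pi.1 hf i) j
  obtain ⟨C, hC⟩ := (isCompact_Icc : IsCompact (Icc D.a D.b)).exists_bound_of_continuousOn hc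
  refine MemLp.of_bound (hc.aestronglyMeasurable measurableSet_Icc) C ?_
  filter_upwards [ae_restrict_mem measurableSet_Icc] with θ hθ using hC θ hθ

/-- The integrand of the moment map is integrable, entry by entry. -/
theorem integrable_moment (ρ : D.HermL2) (i : Fin nl) (j : Fin nr) :
    Integrable (fun θ => (D.Gl θ * ρ.1 θ * D.Gr θ) i j) (volume.restrict D.S) := by
  simp only [Matrix.mul_apply, Finset.sum_mul]
  refine integrable_finsetSum _ fun k _ => integrable_finsetSum _ fun l _ => ?_
  have h1 : Integrable (fun θ => ρ.1 θ l k) (volume.restrict D.S) := by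
    exact (ρ.2.2 l k).integrable (by norm_num)
  have hl : ContinuousOn (fun θ => D.Gl θ i l * D.Gr θ k j) D.S :=
    (D.contDiffOn_Gl i l).continuousOn.mul (D.contDiffOn_Gr k j).continuousOn
  have h2 : IntegrableOn (fun θ => ρ.1 θ l k * (D.Gl θ i l * D.Gr θ k j)) D.S :=
    IntegrableOn.mul_continuousOn h1 hl isCompact_Icc
  refine h2.congr (Eventually.of_forall fun θ => ?_)
  simp only
  ring

/-- The moment map `L ρ = ∫_S Gl ρ Gr dθ` (the integral is taken entrywise). -/
def L : D.HermL2 →ₗ[ℝ] Matrix (Fin nl) (Fin nr) ℂ where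
  toFun ρ := Matrix.of fun i j => ∫ θ in D.S, (D.Gl θ * ρ.1 θ * D.Gr θ) i j
  map_add' ρ σ := by
    ext i j
    simp only [Matrix.of_apply, Matrix.add_apply]
    rw [← integral_add (D.integrable_moment ρ i j) (D.integrable_moment σ i j)]
    simp [Matrix.mul_add, Matrix.add_mul]
  map_smul' c ρ := by
    ext i j
    simp only [Matrix.of_apply, Matrix.smul_apply, RingHom.id_apply]
    rw [← integral_smul]
    simp [Matrix.mul_smul, Matrix.smul_mul]

/-- The moment space: the range of `L`, a real linear space of complex `nl × nr` matrices. -/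
abbrev Mom : Submodule ℝ (Matrix (Fin nl) (Fin nr) ℂ) := LinearMap.range D.L

/-- `L` as a linear map onto the moment space. -/
def Lm : D.HermL2 →ₗ[ℝ] D.Mom := D.L.rangeRestrict

/-- The cone of square integrable densities that are nonnegative definite at every point. -/
def cone : Set D.HermL2 := {ρ | ∀ θ ∈ D.S, (ρ.1 θ).PosSemidef}

/-- The cone of square integrable densities that are positive definite at every point. -/
def posCone : Set D.HermL2 := {ρ | ∀ θ ∈ D.S, (ρ.1 θ).PosDef}

/-- The cone of moments: the closure of `L (cone)` in the moment space. -/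
def K : Set D.Mom := closure (D.Lm '' D.cone)

theorem continuousOn_adj (lam : Matrix (Fin nl) (Fin nr) ℂ) :
    ContinuousOn (fun θ => hermPart ((D.Gl θ)ᴴ * lam * (D.Gr θ)ᴴ)) D.S := by
  have h1 : ContinuousOn (fun θ => (D.Gl θ)ᴴ * lam * (D.Gr θ)ᴴ) D.S := by
    have hl : ContinuousOn (fun θ => (D.Gl θ)ᴴ) D.S :=
      (continuous_id.matrix_conjTranspose).comp_continuousOn D.continuousOn_Gl
    have hr : ContinuousOn (fun θ => (D.Gr θ)ᴴ) D.S :=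
      (continuous_id.matrix_conjTranspose).comp_continuousOn D.continuousOn_Gr
    rw [continuousOn_iff_continuous_domRestrict] at hl hr ⊢
    exact (hl.matrix_mul continuous_const).matrix_mul hr
  have h2 : Continuous (hermPart (m := m)) := by
    unfold hermPart
    fun_prop
  exact h2.comp_continuousOn h1

/-- The adjoint `L* λ = (Glᴴ λ Grᴴ)_Herm` of the moment map. -/
def Ladj : D.Mom →ₗ[ℝ] D.HermL2 where
  toFun lam := ⟨fun θ => hermPart ((D.Gl θ)ᴴ * lam.1 * (D.Gr θ)ᴴ),
    D.mem_HermL2 (D.continuousOn_adj lam.1) fun θ _ => by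
      simp [Matrix.IsHermitian, hermPart, Matrix.conjTranspose_smul, add_comm]⟩
  map_add' x y := by
    ext θ i j
    simp [hermPart, Matrix.mul_add, Matrix.add_mul]
    ring
  map_smul' c x := by
    ext θ i j
    simp [hermPart, Matrix.conjTranspose_smul]
    ring

/-- The interior of the dual cone: the `λ` in the moment space such that `L* λ` is positive
definite at every point of `S`. -/
def dualInt : Set D.Mom := {lam | D.Ladj lam ∈ D.posCone}

theorem continuousOn_Ladj (lam : D.Mom) : ContinuousOn (D.Ladj lam).1 D.S :=
  D.continuousOn_adj lam.1

theorem continuousOn_Ladj_inv (lam : D.dualInt) :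
    ContinuousOn (fun θ => ((D.Ladj lam.1).1 θ)⁻¹) D.S := by
  intro θ hθ
  have hdet : ((D.Ladj lam.1).1 θ).det ≠ 0 :=
    ((Matrix.isUnit_iff_isUnit_det _).1 (lam.2 θ hθ).isUnit).ne_zero
  refine ContinuousAt.comp_continuousWithinAt (g := fun M : Matrix (Fin m) (Fin m) ℂ => M⁻¹)
    (continuousAt_matrix_inv _ ?_) (D.continuousOn_Ladj lam.1 θ hθ)
  simpa using continuousAt_inv₀ hdet

/-- The rational density `ρ = (L* λ)⁻¹` attached to an interior point `λ` of the dual cone. -/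
def ratDensity (lam : D.dualInt) : D.HermL2 :=
  ⟨fun θ => ((D.Ladj lam.1).1 θ)⁻¹, D.mem_HermL2 (D.continuousOn_Ladj_inv lam)
    fun θ hθ => (lam.2 θ hθ).isHermitian.inv⟩

/-- The map `h λ = L ((L* λ)⁻¹)`. -/
def h (lam : D.dualInt) : D.Mom := D.Lm (D.ratDensity lam)

/-- The function `θ ↦ (L* λ)⁻¹ (L* δ) (L* λ)⁻¹`, as a linear function of `δ`. -/
def sandwich (lam : D.dualInt) : D.Mom →ₗ[ℝ] D.HermL2 where
  toFun δ := ⟨fun θ => ((D.Ladj lam.1).1 θ)⁻¹ * (D.Ladj δ).1 θ * ((D.Ladj lam.1).1 θ)⁻¹,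
    D.mem_HermL2
      (by
        have h1 := D.continuousOn_Ladj_inv lam
        have h2 := D.continuousOn_Ladj δ
        rw [continuousOn_iff_continuous_domRestrict] at h1 h2 ⊢
        exact (h1.matrix_mul h2).matrix_mul h1)
      (fun θ hθ => by
        have h1 : (((D.Ladj lam.1).1 θ)⁻¹)ᴴ = ((D.Ladj lam.1).1 θ)⁻¹ :=
          (lam.2 θ hθ).isHermitian.inv
        have h2 : ((D.Ladj δ).1 θ)ᴴ = (D.Ladj δ).1 θ := (D.Ladj δ).2.1 θ hθ
        simp only [Matrix.IsHermitian, Matrix.conjTranspose_mul, h1, h2, Matrix.mul_assoc])⟩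
  map_add' x y := by
    ext θ i j
    simp [Matrix.mul_add, Matrix.add_mul]
  map_smul' c x := by
    ext θ i j
    simp

/-- The Jacobian `∇h|_λ : δ ↦ -L ((L* λ)⁻¹ (L* δ) (L* λ)⁻¹)` of `h` at `λ`, an endomorphism of the
moment space. The minus sign is that of the derivative of the matrix inverse. -/
def gradH (lam : D.dualInt) : Module.End ℝ D.Mom := -(D.Lm ∘ₗ D.sandwich lam)

/-- The positive definite densities with moment `R`. -/
def posConeAt (R : D.Mom) : Set D.HermL2 := {ρ | ρ ∈ D.posCone ∧ D.Lm ρ = R}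

/-- The (real) function `θ ↦ trace (log (ρ θ))`, with the logarithm of the functional calculus. -/
def traceLog (ρ : D.HermL2) (θ : ℝ) : ℝ := ((cfc Real.log (ρ.1 θ)).trace).re

open Classical in
/-- The entropy functional `-∫_S trace (log ρ) dθ` on positive definite densities, with values in
`(-∞, +∞]`. Since `trace (log ρ) ≤ trace ρ` and the latter is integrable, the integral of
`trace (log ρ)` always exists in `[-∞, ∞)`, and is `-∞` precisely if `trace (log ρ)` is not
integrable. -/
def entropy (ρ : D.HermL2) : EReal :=
  if IntegrableOn (D.traceLog ρ) D.S then ((-∫ θ in D.S, D.traceLog ρ θ : ℝ) : EReal) else ⊤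

/-- `ρ` minimizes the entropy functional among the positive definite densities with moment `R`. -/
def IsMinimizer (R : D.Mom) (ρ : D.HermL2) : Prop :=
  ρ ∈ D.posConeAt R ∧ ∀ σ ∈ D.posConeAt R, D.entropy ρ ≤ D.entropy σ

/-- The vector field `λ ↦ (∇h|_λ)⁻¹ (R - L ((L* λ)⁻¹))` on the interior of the dual cone. -/
def vectorField (R : D.Mom) (lam : D.dualInt) : D.Mom := Ring.inverse (D.gradH lam) (R - D.h lam)

/-- `lam` solves `dλ/dt = (∇h|_λ)⁻¹ (R - L ((L* λ)⁻¹))` on the time interval `I`, with values in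
the interior of the dual cone, which is the domain of the vector field. -/
def IsSolution (R : D.Mom) (I : Set ℝ) (lam : ℝ → D.dualInt) : Prop :=
  ∀ t ∈ I, HasDerivWithinAt (fun s => (lam s : D.Mom)) (D.vectorField R (lam t)) I t

/-- The squared norm of an element of the moment space. -/
def sqNorm (x : D.Mom) : ℝ := reInner x.1 x.1

/-- The squared error `V λ = ‖R - L ((L* λ)⁻¹)‖²`. -/
def V (R : D.Mom) (lam : D.dualInt) : ℝ := D.sqNorm (R - D.h lam)

end MomentKernel

end

noncomputable section

/-! The map `h` is a diffeomorphism from `dualInt` onto `interior K`, and in the coordinate `y = h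
λ` the differential equation is linear: `dy/dt = R - y`. Solutions are therefore the preimages under
`h` of the path `R + exp(-t) (h λ₀ - R)`, which runs straight towards `R`. If `R` is interior,
convexity keeps the path in `interior K`, and continuity of the inverse gives convergence. Otherwise
the path leaves `range h` at a first time, or converges to `R` outside it; either way `λ` must be
unbounded.

Injectivity of `h` and invertibility of its Jacobian come from monotonicity: with `X = L* (λ - μ)`,
the pairing of `λ - μ` with `h μ - h λ` is the integral of `tr (X (L* λ)⁻¹ X (L* μ)⁻¹)`, which is
nonnegative and vanishes only for `X = 0` (`h_injective`, `isUnit_gradH`). The inverse function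
theorem then makes `range h` open.

The crux is `mem_dualInt_of_tendsto`: a limit of points along which `h` converges cannot lie on the
boundary. There some form `x* (L* λ) x` would be nonpositive at a point `θ₀`; being Lipschitz, it is
at most `K |θ - θ₀|`, so its reciprocal has infinite integral over an interval. But along the
sequence these integrals are bounded through `h`, and Fatou's lemma passes the bound to the limit.
Hence `λ` is unbounded wherever `h λ` tends to a missed value (`tendsto_sqNorm_atTop`). Inside
`interior K` this is impossible because `⟨λ, h λ⟩` is constant, so `range h` is relatively closed
there, and connectedness gives equality (`range_h_eq_interior_K`).

Minimality of `(L* λ)⁻¹` is the integrated tangent inequality of the strictly concave function `log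
det`, whose linear term depends only on the moment. -/

namespace Matrix

/-! ### Trace, log-determinant and Hermitian-form inequalities for positive matrices -/

section PositiveMatrices

variable {m : ℕ} {P Q X A : Matrix (Fin m) (Fin m) ℂ}

open scoped MatrixOrder in
theorem PosSemidef.exists_eq_conjTranspose_mul_self (hP : P.PosSemidef) :
    ∃ B : Matrix (Fin m) (Fin m) ℂ, P = Bᴴ * B :=
  CStarAlgebra.nonneg_iff_eq_star_mul_self.mp hP.nonneg

theorem PosDef.exists_isUnit_eq_conjTranspose_mul_self (hP : P.PosDef) :
    ∃ B : Matrix (Fin m) (Fin m) ℂ, IsUnit B ∧ P = Bᴴ * B := by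
  obtain ⟨B, rfl⟩ := hP.posSemidef.exists_eq_conjTranspose_mul_self
  refine ⟨B, ?_, rfl⟩
  have h := hP.isUnit
  rw [isUnit_iff_isUnit_det, det_mul] at h
  exact (isUnit_iff_isUnit_det _).2 (isUnit_of_mul_isUnit_right h)

theorem PosSemidef.re_trace_nonneg (hP : P.PosSemidef) : 0 ≤ P.trace.re :=
  (Complex.le_def.1 hP.trace_nonneg).1

theorem PosSemidef.re_trace_eq_zero_iff (hP : P.PosSemidef) : P.trace.re = 0 ↔ P = 0 := by
  rw [← hP.trace_eq_zero_iff]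
  have h := (Complex.le_def.1 hP.trace_nonneg).2
  constructor
  · intro h0
    exact Complex.ext h0 h.symm
  · intro h0
    rw [h0, Complex.zero_re]

/-- With `P = Bᴴ B`, cyclicity turns the trace into that of `B Q Bᴴ`. -/
theorem PosSemidef.re_trace_mul_nonneg (hP : P.PosSemidef) (hQ : Q.PosSemidef) :
    0 ≤ ((P * Q).trace).re := by
  obtain ⟨B, rfl⟩ := hP.exists_eq_conjTranspose_mul_self
  rw [Matrix.mul_assoc, trace_mul_comm, Matrix.mul_assoc]
  simpa [Matrix.mul_assoc] using (hQ.mul_mul_conjTranspose_same B).re_trace_nonneg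

theorem PosSemidef.eq_zero_of_re_trace_mul_eq_zero (hP : P.PosSemidef) (hQ : Q.PosDef)
    (h : ((P * Q).trace).re = 0) : P = 0 := by
  obtain ⟨C, hC, rfl⟩ := hQ.exists_isUnit_eq_conjTranspose_mul_self
  rw [← Matrix.mul_assoc, trace_mul_comm, ← Matrix.mul_assoc,
    (hP.mul_mul_conjTranspose_same C).re_trace_eq_zero_iff, Matrix.mul_assoc,
    hC.mul_right_eq_zero] at h
  exact (hC.star.mul_left_eq_zero).1 h

/-- `X P X` is a congruence of `P`, hence positive semidefinite. This integrand drives the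
monotonicity of `h`. -/
theorem IsHermitian.re_trace_sandwich_nonneg (hX : X.IsHermitian) (hP : P.PosDef) (hQ : Q.PosDef) :
    0 ≤ ((X * P * X * Q).trace).re := by
  have h := hP.posSemidef.mul_mul_conjTranspose_same X
  rw [hX.eq] at h
  exact h.re_trace_mul_nonneg hQ.posSemidef

theorem IsHermitian.eq_zero_of_re_trace_sandwich_eq_zero (hX : X.IsHermitian) (hP : P.PosDef)
    (hQ : Q.PosDef) (h0 : ((X * P * X * Q).trace).re = 0) : X = 0 := by
  have h := hP.posSemidef.mul_mul_conjTranspose_same X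
  rw [hX.eq] at h
  have h1 := h.eq_zero_of_re_trace_mul_eq_zero hQ h0
  obtain ⟨C, hC, rfl⟩ := hP.exists_isUnit_eq_conjTranspose_mul_self
  have h2 : (C * X)ᴴ * (C * X) = 0 := by
    rw [conjTranspose_mul, hX.eq, ← h1]
    simp only [Matrix.mul_assoc]
  rw [conjTranspose_mul_self_eq_zero, hC.mul_right_eq_zero] at h2
  exact h2

theorem trace_cfc_log (hA : A.PosDef) :
    ((cfc Real.log A).trace).re = Real.log (A.det.re) := by
  rw [hA.1.cfc_eq, hA.1.det_eq_prod_eigenvalues, IsHermitian.cfc,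
    Unitary.conjStarAlgAut_apply, trace_mul_comm, ← Matrix.mul_assoc]
  simp only [Unitary.coe_star_mul_self, Matrix.one_mul, trace_diagonal, Function.comp_apply]
  have : (∏ i, (hA.1.eigenvalues i : ℂ)).re = ∏ i, hA.1.eigenvalues i := by
    rw [← Complex.ofReal_prod, Complex.ofReal_re]
  erw [this, Real.log_prod fun i _ => (hA.eigenvalues_pos i).ne']
  simp

/-- The scalar inequality `log x ≤ x - 1`, summed over the eigenvalues; its equality case `x = 1`
gives the next lemma. -/
theorem PosDef.log_det_le (hA : A.PosDef) : Real.log (A.det.re) ≤ A.trace.re - m := by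
  rw [hA.1.det_eq_prod_eigenvalues, hA.1.trace_eq_sum_eigenvalues]
  have : (∏ i, (hA.1.eigenvalues i : ℂ)).re = ∏ i, hA.1.eigenvalues i := by
    rw [← Complex.ofReal_prod, Complex.ofReal_re]
  erw [this, Real.log_prod fun i _ => (hA.eigenvalues_pos i).ne']
  have h2 : ((∑ i, (hA.1.eigenvalues i : ℂ)).re) - m = ∑ i, (hA.1.eigenvalues i - 1) := by
    simp
  erw [h2]
  exact Finset.sum_le_sum fun i _ => Real.log_le_sub_one_of_pos (hA.eigenvalues_pos i)

theorem PosDef.eq_one_of_log_det_eq (hA : A.PosDef)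
    (h : Real.log (A.det.re) = A.trace.re - m) : A = 1 := by
  rw [hA.1.det_eq_prod_eigenvalues, hA.1.trace_eq_sum_eigenvalues] at h
  have : (∏ i, (hA.1.eigenvalues i : ℂ)).re = ∏ i, hA.1.eigenvalues i := by
    rw [← Complex.ofReal_prod, Complex.ofReal_re]
  erw [this, Real.log_prod fun i _ => (hA.eigenvalues_pos i).ne'] at h
  have h2 : ((∑ i, (hA.1.eigenvalues i : ℂ)).re) - m = ∑ i, (hA.1.eigenvalues i - 1) := by
    simp
  erw [h2] at h
  have h3 := (Finset.sum_eq_sum_iff_of_le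
    fun i _ => Real.log_le_sub_one_of_pos (hA.eigenvalues_pos i)).1 h
  have h4 : ∀ i, hA.1.eigenvalues i = 1 := by
    intro i
    by_contra hne
    exact (Real.log_lt_sub_one_of_pos (hA.eigenvalues_pos i) hne).ne (h3 i (Finset.mem_univ i))
  rw [hA.1.spectral_theorem]
  have h5 : diagonal (RCLike.ofReal ∘ hA.1.eigenvalues) = (1 : Matrix (Fin m) (Fin m) ℂ) := by
    rw [← diagonal_one]
    congr 1
    ext i
    simp [h4]
  rw [h5, map_one]

/-- The whitening of `σ` with respect to `ρ`. -/
theorem PosDef.exists_whitening (hP : P.PosDef) (hQ : Q.PosDef) :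
    ∃ M : Matrix (Fin m) (Fin m) ℂ, M.PosDef ∧
      Real.log M.det.re = Real.log P.det.re - Real.log Q.det.re ∧
      M.trace = (Q⁻¹ * P).trace ∧ (M = 1 → P = Q) := by
  obtain ⟨C, hC, hQC⟩ := hQ.exists_isUnit_eq_conjTranspose_mul_self
  have hCd : IsUnit C.det := (isUnit_iff_isUnit_det _).1 hC
  have hCd' : IsUnit (Cᴴ).det := (isUnit_iff_isUnit_det _).1 hC.star
  -- With `Q = Cᴴ C`, the congruence by `C⁻¹` carries `Q` to the identity and `P` to the required
  -- matrix.
  have hM : ((C⁻¹)ᴴ * P * C⁻¹).PosDef := by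
    refine hP.conjTranspose_mul_mul_same ?_
    exact mulVec_injective_iff_isUnit.2 ((isUnit_nonsing_inv_iff).2 hC)
  have him : ∀ {B : Matrix (Fin m) (Fin m) ℂ}, B.PosDef →
      B.det = (B.det.re : ℂ) ∧ 0 < B.det.re := by
    intro B hB
    have := Complex.lt_def.1 hB.det_pos
    exact ⟨Complex.ext rfl (by simpa using this.2.symm), this.1⟩
  have hP' : P = Cᴴ * ((C⁻¹)ᴴ * P * C⁻¹) * C := by
    rw [conjTranspose_nonsing_inv, Matrix.mul_assoc, Matrix.mul_assoc,
      nonsing_inv_mul _ hCd, Matrix.mul_one, mul_nonsing_inv_cancel_left _ _ hCd']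
  refine ⟨(C⁻¹)ᴴ * P * C⁻¹, hM, ?_, ?_, ?_⟩
  · have h1 : P.det = ((C⁻¹)ᴴ * P * C⁻¹).det * Q.det := by
      conv_lhs => rw [hP']
      rw [det_mul, det_mul, hQC, det_mul Cᴴ C]
      ring
    obtain ⟨e1, p1⟩ := him hM
    obtain ⟨e2, p2⟩ := him hQ
    have h2 : P.det.re = ((C⁻¹)ᴴ * P * C⁻¹).det.re * Q.det.re := by
      rw [h1, e1, e2]
      simp
    rw [h2, Real.log_mul p1.ne' p2.ne']
    ring
  · rw [Matrix.mul_assoc, trace_mul_comm, Matrix.mul_assoc, trace_mul_comm, hQC, mul_inv_rev,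
      conjTranspose_nonsing_inv]
  · intro h
    rw [hP', h, Matrix.mul_one, hQC]

/-- Whitening reduces the tangent inequality of `log det` at `Q` to the one at the identity. -/
theorem PosDef.log_det_sub_le (hP : P.PosDef) (hQ : Q.PosDef) :
    Real.log P.det.re - Real.log Q.det.re ≤ ((Q⁻¹ * P).trace).re - m := by
  obtain ⟨M, hM, hl, ht, -⟩ := hP.exists_whitening hQ
  rw [← hl, ← ht]
  exact hM.log_det_le

theorem PosDef.eq_of_log_det_sub_eq (hP : P.PosDef) (hQ : Q.PosDef)
    (h : Real.log P.det.re - Real.log Q.det.re = ((Q⁻¹ * P).trace).re - m) : P = Q := by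
  obtain ⟨M, hM, hl, ht, h1⟩ := hP.exists_whitening hQ
  rw [← hl, ← ht] at h
  exact h1 (hM.eq_one_of_log_det_eq h)

/-- The Hermitian form `x* A x`, as a real number. -/
def quadRe (A : Matrix (Fin m) (Fin m) ℂ) (x : Fin m → ℂ) : ℝ := (star x ⬝ᵥ (A *ᵥ x)).re

theorem quadRe_add (A B : Matrix (Fin m) (Fin m) ℂ) (x : Fin m → ℂ) :
    quadRe (A + B) x = quadRe A x + quadRe B x := by
  simp [quadRe, add_mulVec, dotProduct_add]

theorem quadRe_smul (c : ℝ) (A : Matrix (Fin m) (Fin m) ℂ) (x : Fin m → ℂ) :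
    quadRe (c • A) x = c * quadRe A x := by
  simp [quadRe, smul_mulVec, dotProduct_smul]

theorem quadRe_conjTranspose (A : Matrix (Fin m) (Fin m) ℂ) (x : Fin m → ℂ) :
    quadRe Aᴴ x = quadRe A x := by
  have : star x ⬝ᵥ (Aᴴ *ᵥ x) = star (star x ⬝ᵥ (A *ᵥ x)) := by
    rw [star_dotProduct, star_mulVec, conjTranspose_conjTranspose, ← dotProduct_mulVec]
  rw [quadRe, this]
  rfl

theorem quadRe_hermPart (A : Matrix (Fin m) (Fin m) ℂ) (x : Fin m → ℂ) :
    quadRe (hermPart A) x = quadRe A x := by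
  rw [hermPart, quadRe_smul, quadRe_add, quadRe_conjTranspose]
  ring

theorem continuous_quadRe :
    Continuous fun q : Matrix (Fin m) (Fin m) ℂ × (Fin m → ℂ) => quadRe q.1 q.2 := by
  unfold quadRe
  fun_prop

theorem PosDef.quadRe_pos (hA : A.PosDef) {x : Fin m → ℂ} (hx : x ≠ 0) : 0 < quadRe A x :=
  (Complex.lt_def.1 (hA.dotProduct_mulVec_pos hx)).1

theorem PosSemidef.quadRe_nonneg (hA : A.PosSemidef) (x : Fin m → ℂ) : 0 ≤ quadRe A x :=
  (Complex.le_def.1 (hA.dotProduct_mulVec_nonneg x)).1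

theorem quadRe_smul_vec (c : ℝ) (A : Matrix (Fin m) (Fin m) ℂ) (x : Fin m → ℂ) :
    quadRe A (c • x) = c ^ 2 * quadRe A x := by
  have : star (c • x) = c • star x := by
    ext i
    simp
  simp [quadRe, this, mulVec_smul, dotProduct_smul]
  ring

/-- Homogeneity reduces to the unit sphere, here of the sup norm; only its compactness matters
later. -/
theorem IsHermitian.posDef_of_quadRe_pos (hA : A.IsHermitian)
    (h : ∀ x ∈ Metric.sphere (0 : Fin m → ℂ) 1, 0 < quadRe A x) : A.PosDef := by
  refine .of_dotProduct_mulVec_pos hA fun x hx => ?_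
  have hn : 0 < ‖x‖ := norm_pos_iff.2 hx
  have h1 := h (‖x‖⁻¹ • x) (by simp [norm_smul, hn.ne'])
  rw [quadRe_smul_vec] at h1
  rw [Complex.lt_def]
  refine ⟨pos_of_mul_pos_right h1 (sq_nonneg _), ?_⟩
  exact (hA.im_star_dotProduct_mulVec_self x).symm

/-- Cauchy-Schwarz for the Hermitian form of a positive definite matrix and its inverse. -/
theorem PosDef.sq_le_quadRe_mul_quadRe_inv (hA : A.PosDef) (x : Fin m → ℂ) :
    (star x ⬝ᵥ x).re ^ 2 ≤ quadRe A x * quadRe A⁻¹ x := by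
  have hd : IsUnit A.det := (isUnit_iff_isUnit_det _).1 hA.isUnit
  -- The quadratic polynomial is the form of `A` at `t x - A⁻¹ x`, so its discriminant is
  -- nonpositive.
  have key : ∀ t : ℝ, 0 ≤ quadRe A x * (t * t) + (-2 * (star x ⬝ᵥ x).re) * t + quadRe A⁻¹ x := by
    intro t
    have h := hA.posSemidef.quadRe_nonneg (t • x - A⁻¹ *ᵥ x)
    have e1 : A *ᵥ (t • x - A⁻¹ *ᵥ x) = t • (A *ᵥ x) - x := by
      rw [mulVec_sub, mulVec_smul, mulVec_mulVec, mul_nonsing_inv _ hd, one_mulVec]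
    have e2 : star (A⁻¹ *ᵥ x) ⬝ᵥ (A *ᵥ x) = star x ⬝ᵥ x := by
      rw [star_mulVec, hA.isHermitian.inv.eq, ← dotProduct_mulVec, mulVec_mulVec,
        nonsing_inv_mul _ hd, one_mulVec]
    have e3 : star (A⁻¹ *ᵥ x) ⬝ᵥ x = star x ⬝ᵥ (A⁻¹ *ᵥ x) := by
      rw [star_mulVec, hA.isHermitian.inv.eq, ← dotProduct_mulVec]
    have e4 : star (t • x) = t • star x := by
      ext i
      simp
    rw [quadRe, e1, star_sub, e4] at h
    simp only [sub_dotProduct, dotProduct_sub, smul_dotProduct, dotProduct_smul, e2, e3,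
      Complex.sub_re, Complex.smul_re, smul_eq_mul] at h
    unfold quadRe
    linarith
  have := discrim_le_zero key
  rw [discrim] at this
  nlinarith

/-- With `Q = Bᴴ B` this says `‖B x‖² ≤ ‖x‖² ‖B‖²` for the Frobenius norm: Cauchy-Schwarz in each
row. -/
theorem PosSemidef.quadRe_le (hQ : Q.PosSemidef) (x : Fin m → ℂ) :
    quadRe Q x ≤ (star x ⬝ᵥ x).re * Q.trace.re := by
  obtain ⟨B, rfl⟩ := hQ.exists_eq_conjTranspose_mul_self
  have e1 : quadRe (Bᴴ * B) x = ∑ i, ‖(B *ᵥ x) i‖ ^ 2 := by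
    rw [quadRe, ← mulVec_mulVec, dotProduct_mulVec, vecMul_conjTranspose, star_star]
    simp [dotProduct, ← Complex.normSq_eq_norm_sq, Complex.normSq_apply]
  have e2 : (star x ⬝ᵥ x).re = ∑ j, ‖x j‖ ^ 2 := by
    simp [dotProduct, ← Complex.normSq_eq_norm_sq, Complex.normSq_apply]
  have e3 : (Bᴴ * B).trace.re = ∑ i, ∑ j, ‖B i j‖ ^ 2 := by
    rw [Finset.sum_comm]
    simp [trace, mul_apply, ← Complex.normSq_eq_norm_sq, Complex.normSq_apply]
  rw [e1, e2, e3, Finset.mul_sum]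
  refine Finset.sum_le_sum fun i _ => ?_
  have h1 : ‖(B *ᵥ x) i‖ ≤ ∑ j, ‖x j‖ * ‖B i j‖ := by
    refine (norm_sum_le Finset.univ fun j => B i j * x j).trans
      (Finset.sum_le_sum fun j _ => ?_)
    rw [norm_mul, mul_comm]
  exact (pow_le_pow_left₀ (norm_nonneg _) h1 2).trans (Finset.sum_mul_sq_le_sq_mul_sq _ _ _)

/-- The form of `Q` is bounded by its trace against a positive definite weight `A`. -/
theorem PosDef.quadRe_le_quadRe_inv_mul (hA : A.PosDef) (hQ : Q.PosSemidef) (x : Fin m → ℂ) :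
    quadRe Q x ≤ quadRe A⁻¹ x * ((A * Q).trace).re := by
  obtain ⟨C, hC, rfl⟩ := hA.exists_isUnit_eq_conjTranspose_mul_self
  have hCd : IsUnit C.det := (isUnit_iff_isUnit_det _).1 hC
  have hCd' : IsUnit (Cᴴ).det := (isUnit_iff_isUnit_det _).1 hC.star
  -- For `A = Cᴴ C`, the unweighted bound is applied to `C Q Cᴴ` at the vector `(Cᴴ)⁻¹ x`.
  have h := (hQ.mul_mul_conjTranspose_same C).quadRe_le ((Cᴴ)⁻¹ *ᵥ x)
  have e1 : quadRe (C * Q * Cᴴ) ((Cᴴ)⁻¹ *ᵥ x) = quadRe Q x := by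
    rw [quadRe, star_mulVec, mulVec_mulVec, mul_nonsing_inv_cancel_right _ _ hCd',
      ← mulVec_mulVec, ← dotProduct_mulVec, mulVec_mulVec, conjTranspose_nonsing_inv,
      conjTranspose_conjTranspose, nonsing_inv_mul _ hCd, one_mulVec, quadRe]
  have e2 : (star ((Cᴴ)⁻¹ *ᵥ x) ⬝ᵥ ((Cᴴ)⁻¹ *ᵥ x)).re = quadRe (Cᴴ * C)⁻¹ x := by
    rw [star_mulVec, ← dotProduct_mulVec, mulVec_mulVec, conjTranspose_nonsing_inv,
      conjTranspose_conjTranspose, quadRe, mul_inv_rev]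
  have e3 : (C * Q * Cᴴ).trace = (Cᴴ * C * Q).trace := by
    rw [trace_mul_comm, ← Matrix.mul_assoc]
  rwa [e1, e2, e3] at h

end PositiveMatrices

end Matrix

/-! ### The real inner product and Hermitian parts -/

theorem reInner_sub_right {p q : ℕ} (A B C : Matrix (Fin p) (Fin q) ℂ) :
    reInner A (B - C) = reInner A B - reInner A C := by
  simp [reInner, Matrix.mul_sub]

theorem reInner_smul_right {p q : ℕ} (c : ℝ) (A B : Matrix (Fin p) (Fin q) ℂ) :
    reInner A (c • B) = c * reInner A B := by
  simp [reInner]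

theorem reInner_self {p q : ℕ} (A : Matrix (Fin p) (Fin q) ℂ) :
    reInner A A = ∑ i, ∑ j, ‖A i j‖ ^ 2 := by
  rw [Finset.sum_comm]
  simp [reInner, Matrix.trace, Matrix.mul_apply, ← Complex.normSq_eq_norm_sq, Complex.normSq_apply]

theorem continuous_reInner {p q : ℕ} (A : Matrix (Fin p) (Fin q) ℂ) : Continuous (reInner A) := by
  unfold reInner
  fun_prop

theorem continuous_hermPart {m : ℕ} : Continuous (hermPart (m := m)) := by
  unfold hermPart
  fun_prop

theorem hermPart_isHermitian {m : ℕ} (M : Matrix (Fin m) (Fin m) ℂ) :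
    (hermPart M).IsHermitian := by
  simp [Matrix.IsHermitian, hermPart, Matrix.conjTranspose_smul, add_comm]

theorem hermPart_of_isHermitian {m : ℕ} {M : Matrix (Fin m) (Fin m) ℂ} (hM : M.IsHermitian) :
    hermPart M = M := by
  rw [hermPart, hM.eq, ← two_smul ℝ M, smul_smul]
  norm_num

/-- Against a Hermitian `P`, the matrices `M` and `Mᴴ` have the same real trace. -/
theorem re_trace_hermPart_mul {m : ℕ} (M : Matrix (Fin m) (Fin m) ℂ)
    {P : Matrix (Fin m) (Fin m) ℂ} (hP : P.IsHermitian) :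
    ((hermPart M * P).trace).re = ((Mᴴ * P).trace).re := by
  have h : ((M * P).trace).re = ((Mᴴ * P).trace).re := by
    have h1 : (Mᴴ * P).trace = star (M * P).trace := by
      rw [← Matrix.trace_conjTranspose, Matrix.conjTranspose_mul, hP.eq, Matrix.trace_mul_comm]
    rw [h1]
    rfl
  rw [hermPart, Matrix.smul_mul, Matrix.trace_smul, Complex.smul_re, Matrix.add_mul,
    Matrix.trace_add, Complex.add_re, h, smul_eq_mul]
  ring

/-! ### Adjointness and monotonicity of the moment map -/

namespace MomentKernel

variable {m nl nr : ℕ} (D : MomentKernel m nl nr)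

theorem isCompact_S : IsCompact D.S := isCompact_Icc

theorem measurableSet_S : MeasurableSet D.S := measurableSet_Icc

theorem trace_conjTranspose_mul_L (lam : Matrix (Fin nl) (Fin nr) ℂ) (ρ : D.HermL2) :
    Integrable (fun θ => (lamᴴ * (D.Gl θ * ρ.1 θ * D.Gr θ)).trace) (volume.restrict D.S) ∧
    (lamᴴ * D.L ρ).trace = ∫ θ in D.S, (lamᴴ * (D.Gl θ * ρ.1 θ * D.Gr θ)).trace := by
  have hi : ∀ i j, Integrable (fun θ => lamᴴ i j * (D.Gl θ * ρ.1 θ * D.Gr θ) j i)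
      (volume.restrict D.S) := fun i j => (D.integrable_moment ρ j i).const_mul _
  have htr : ∀ M : Matrix (Fin nl) (Fin nr) ℂ,
      (lamᴴ * M).trace = ∑ i, ∑ j, lamᴴ i j * M j i := fun M => rfl
  simp only [htr]
  refine ⟨integrable_finsetSum _ fun i _ => integrable_finsetSum _ fun j _ => hi i j, ?_⟩
  rw [integral_finsetSum _ fun i _ => integrable_finsetSum _ fun j _ => hi i j]
  refine Finset.sum_congr rfl fun i _ => ?_
  rw [integral_finsetSum _ fun j _ => hi i j]
  refine Finset.sum_congr rfl fun j _ => ?_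
  rw [integral_const_mul]
  rfl

theorem re_trace_Ladj_mul (lam : D.Mom) (ρ : D.HermL2) {θ : ℝ} (hθ : θ ∈ D.S) :
    (((D.Ladj lam).1 θ * ρ.1 θ).trace).re =
      ((lam.1ᴴ * (D.Gl θ * ρ.1 θ * D.Gr θ)).trace).re := by
  change ((hermPart ((D.Gl θ)ᴴ * lam.1 * (D.Gr θ)ᴴ) * ρ.1 θ).trace).re = _
  rw [re_trace_hermPart_mul _ (ρ.2.1 θ hθ)]
  congr 1
  simp only [Matrix.conjTranspose_mul, Matrix.conjTranspose_conjTranspose]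
  rw [Matrix.mul_assoc, Matrix.trace_mul_comm]
  simp only [Matrix.mul_assoc]

theorem integrable_re_trace_Ladj_mul (lam : D.Mom) (ρ : D.HermL2) :
    IntegrableOn (fun θ => (((D.Ladj lam).1 θ * ρ.1 θ).trace).re) D.S := by
  refine ((D.trace_conjTranspose_mul_L lam.1 ρ).1.re).congr ?_
  filter_upwards [ae_restrict_mem D.measurableSet_S] with θ hθ
  exact (D.re_trace_Ladj_mul lam ρ hθ).symm

/-- `Ladj` is the adjoint of `L`. -/
theorem reInner_Lm (lam : D.Mom) (ρ : D.HermL2) :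
    reInner lam.1 (D.Lm ρ).1 = ∫ θ in D.S, (((D.Ladj lam).1 θ * ρ.1 θ).trace).re := by
  obtain ⟨hi, he⟩ := D.trace_conjTranspose_mul_L lam.1 ρ
  change ((lam.1ᴴ * D.L ρ).trace).re = _
  rw [he, setIntegral_congr_fun D.measurableSet_S fun θ hθ => D.re_trace_Ladj_mul lam ρ hθ]
  exact (integral_re hi).symm

theorem sqNorm_eq_zero {x : D.Mom} (hx : D.sqNorm x = 0) : x = 0 := by
  rw [sqNorm, reInner_self, Finset.sum_eq_zero_iff_of_nonneg fun i _ => by positivity] at hx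
  ext i j
  have h1 := hx i (Finset.mem_univ i)
  rw [Finset.sum_eq_zero_iff_of_nonneg fun i _ => by positivity] at h1
  simpa using h1 j (Finset.mem_univ j)

/-- Since `δ` lies in the range of `L`, say `δ = L ρ`, adjointness gives `‖δ‖² = ⟨δ, L ρ⟩ = 0`. -/
theorem eq_zero_of_Ladj_eq_zero {δ : D.Mom} (h : ∀ θ ∈ D.S, (D.Ladj δ).1 θ = 0) : δ = 0 := by
  obtain ⟨ρ, hρ⟩ := δ.2
  have h1 : D.Lm ρ = δ := Subtype.ext hρ
  refine D.sqNorm_eq_zero ?_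
  have h2 := D.reInner_Lm δ ρ
  rw [h1] at h2
  rw [sqNorm, h2, setIntegral_congr_fun D.measurableSet_S fun θ hθ => by rw [h θ hθ]]
  simp

theorem _root_.ContinuousOn.matrix_mul' {p q r : ℕ} {s : Set ℝ}
    {A : ℝ → Matrix (Fin p) (Fin q) ℂ} {B : ℝ → Matrix (Fin q) (Fin r) ℂ}
    (hA : ContinuousOn A s) (hB : ContinuousOn B s) : ContinuousOn (fun θ => A θ * B θ) s := by
  rw [continuousOn_iff_continuous_domRestrict] at hA hB ⊢
  exact hA.matrix_mul hB

/-- A nonnegative integrand with zero integral vanishes almost everywhere, and by continuity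
everywhere on the nondegenerate interval. -/
theorem eq_zero_of_integral_sandwich_eq_zero {P Q : ℝ → Matrix (Fin m) (Fin m) ℂ}
    (hPc : ContinuousOn P D.S) (hQc : ContinuousOn Q D.S)
    (hP : ∀ θ ∈ D.S, (P θ).PosDef) (hQ : ∀ θ ∈ D.S, (Q θ).PosDef) {δ : D.Mom}
    (h0 : ∫ θ in D.S, (((D.Ladj δ).1 θ * P θ * (D.Ladj δ).1 θ * Q θ).trace).re = 0) : δ = 0 := by
  have hX := D.continuousOn_Ladj δ
  have hc : ContinuousOn (fun θ => (((D.Ladj δ).1 θ * P θ * (D.Ladj δ).1 θ * Q θ).trace).re)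
      D.S := by
    have h1 : Continuous fun M : Matrix (Fin m) (Fin m) ℂ => M.trace.re := by fun_prop
    exact h1.comp_continuousOn (((hX.matrix_mul' hPc).matrix_mul' hX).matrix_mul' hQc)
  have hn : ∀ θ ∈ D.S, 0 ≤ (((D.Ladj δ).1 θ * P θ * (D.Ladj δ).1 θ * Q θ).trace).re :=
    fun θ hθ => ((D.Ladj δ).2.1 θ hθ).re_trace_sandwich_nonneg (hP θ hθ) (hQ θ hθ)
  have hi := hc.integrableOn_compact (μ := volume) D.isCompact_S
  have hae : _ =ᵐ[volume.restrict D.S] _ := (setIntegral_eq_zero_iff_of_nonneg_ae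
    (by filter_upwards [ae_restrict_mem D.measurableSet_S] with θ hθ using hn θ hθ) hi).1 h0
  have heq := Measure.eqOn_Icc_of_ae_eq volume D.a_lt_b.ne hae hc continuousOn_const
  exact D.eq_zero_of_Ladj_eq_zero fun θ hθ =>
    ((D.Ladj δ).2.1 θ hθ).eq_zero_of_re_trace_sandwich_eq_zero (hP θ hθ) (hQ θ hθ) (heq hθ)

theorem ratDensity_posDef (lam : D.dualInt) {θ : ℝ} (hθ : θ ∈ D.S) :
    ((D.ratDensity lam).1 θ).PosDef :=
  (lam.2 θ hθ).inv

theorem reInner_h (δ : D.Mom) (lam : D.dualInt) :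
    reInner δ.1 (D.h lam).1 =
      ∫ θ in D.S, (((D.Ladj δ).1 θ * ((D.Ladj lam.1).1 θ)⁻¹).trace).re :=
  D.reInner_Lm δ (D.ratDensity lam)

/-- With `A = L* λ`, `B = L* μ` and `X = A - B`, the identity `B⁻¹ - A⁻¹ = A⁻¹ X B⁻¹` makes `⟨λ - μ,
h μ - h λ⟩` a sandwich integral. -/
theorem h_injective : Function.Injective D.h := by
  intro lam mu heq
  have h1 : reInner (lam.1 - mu.1 : D.Mom).1 (D.h mu).1
      - reInner (lam.1 - mu.1 : D.Mom).1 (D.h lam).1 = 0 := by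
    rw [heq, sub_self]
  have hA := D.continuousOn_Ladj_inv lam
  have hB := D.continuousOn_Ladj_inv mu
  rw [h, h, reInner_Lm, reInner_Lm, ← integral_sub (D.integrable_re_trace_Ladj_mul _ _)
    (D.integrable_re_trace_Ladj_mul _ _)] at h1
  refine Subtype.ext (sub_eq_zero.1 (D.eq_zero_of_integral_sandwich_eq_zero hA hB
    (fun θ hθ => (lam.2 θ hθ).inv) (fun θ hθ => (mu.2 θ hθ).inv) ?_))
  rw [← h1]
  refine setIntegral_congr_fun D.measurableSet_S fun θ hθ => ?_
  change _ = (((D.Ladj (lam.1 - mu.1)).1 θ * ((D.Ladj mu.1).1 θ)⁻¹).trace).re -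
    (((D.Ladj (lam.1 - mu.1)).1 θ * ((D.Ladj lam.1).1 θ)⁻¹).trace).re
  have hx : (D.Ladj (lam.1 - mu.1)).1 θ = (D.Ladj lam.1).1 θ - (D.Ladj mu.1).1 θ := by
    rw [map_sub]
    rfl
  have h1 := (Matrix.isUnit_iff_isUnit_det _).1 (lam.2 θ hθ).isUnit
  have h2 := (Matrix.isUnit_iff_isUnit_det _).1 (mu.2 θ hθ).isUnit
  simp only [hx]
  rw [← Complex.sub_re, ← Matrix.trace_sub, ← Matrix.mul_sub]
  congr 2
  simp only [Matrix.mul_assoc]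
  congr 1
  rw [Matrix.sub_mul, Matrix.mul_nonsing_inv _ h2, Matrix.mul_sub, Matrix.mul_one,
    ← Matrix.mul_assoc, Matrix.nonsing_inv_mul _ h1, Matrix.one_mul]

/-- In finite dimension a trivial kernel suffices, and `-⟨δ, ∇h δ⟩` is a definite sandwich integral.
-/
theorem isUnit_gradH (lam : D.dualInt) : IsUnit (D.gradH lam) := by
  rw [LinearMap.isUnit_iff_ker_eq_bot, LinearMap.ker_eq_bot']
  intro δ hδ
  have h1 : D.Lm (D.sandwich lam δ) = 0 := by
    have : -(D.Lm (D.sandwich lam δ)) = 0 := hδ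
    rwa [neg_eq_zero] at this
  have h2 := D.reInner_Lm δ (D.sandwich lam δ)
  rw [h1] at h2
  have h3 : reInner δ.1 (0 : D.Mom).1 = 0 := by simp [reInner]
  have hA := D.continuousOn_Ladj_inv lam
  refine D.eq_zero_of_integral_sandwich_eq_zero hA hA
    (fun θ hθ => (lam.2 θ hθ).inv) (fun θ hθ => (lam.2 θ hθ).inv) ?_
  rw [← h3, h2]
  refine setIntegral_congr_fun D.measurableSet_S fun θ _ => ?_
  change _ = (((D.Ladj δ).1 θ * (((D.Ladj lam.1).1 θ)⁻¹ * (D.Ladj δ).1 θ *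
    ((D.Ladj lam.1).1 θ)⁻¹)).trace).re
  simp only [Matrix.mul_assoc]

/-! ### Openness of the dual cone's interior -/

/-- The projection of the real line onto the support. -/
def proj (θ : ℝ) : D.S := projIcc D.a D.b D.a_lt_b.le θ

theorem continuous_proj : Continuous D.proj :=
  continuous_projIcc (h := D.a_lt_b.le)

theorem proj_of_mem {θ : ℝ} (hθ : θ ∈ D.S) : D.proj θ = ⟨θ, hθ⟩ :=
  projIcc_of_mem D.a_lt_b.le hθ

theorem continuous_Gl_proj : Continuous fun θ => D.Gl (D.proj θ) :=
  D.continuousOn_Gl.comp_continuous (continuous_subtype_val.comp D.continuous_proj)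
    fun θ => (D.proj θ).2

theorem continuous_Gr_proj : Continuous fun θ => D.Gr (D.proj θ) :=
  D.continuousOn_Gr.comp_continuous (continuous_subtype_val.comp D.continuous_proj)
    fun θ => (D.proj θ).2

theorem continuous_Ladj_proj :
    Continuous fun q : D.Mom × ℝ => (D.Ladj q.1).1 (D.proj q.2) := by
  have h1 := D.continuous_Gl_proj
  have h2 := D.continuous_Gr_proj
  have h3 : Continuous fun q : D.Mom × ℝ =>
      (D.Gl (D.proj q.2))ᴴ * q.1.1 * (D.Gr (D.proj q.2))ᴴ :=
    ((h1.comp continuous_snd).matrix_conjTranspose.matrix_mul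
      (continuous_subtype_val.comp continuous_fst)).matrix_mul
      (h2.comp continuous_snd).matrix_conjTranspose
  exact continuous_hermPart.comp h3

theorem mem_dualInt_iff {lam : D.Mom} :
    lam ∈ D.dualInt ↔ ∀ θ ∈ D.S, ((D.Ladj lam).1 θ).PosDef := Iff.rfl

/-- Positivity of a jointly continuous form on the compact set of pairs `(θ, x)`, with `x` in the
unit sphere, persists near `lam`. -/
theorem isOpen_dualInt : IsOpen D.dualInt := by
  rw [isOpen_iff_mem_nhds]
  intro lam hlam
  have hK : IsCompact (D.S ×ˢ Metric.sphere (0 : Fin m → ℂ) 1) :=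
    D.isCompact_S.prod (isCompact_sphere _ _)
  have hc : Continuous fun q : D.Mom × (ℝ × (Fin m → ℂ)) =>
      Matrix.quadRe ((D.Ladj q.1).1 (D.proj q.2.1)) q.2.2 :=
    Matrix.continuous_quadRe.comp ((D.continuous_Ladj_proj.comp
      (continuous_fst.prodMk (continuous_fst.comp continuous_snd))).prodMk
      (continuous_snd.comp continuous_snd))
  have h := hK.eventually_forall_of_forall_eventually (x₀ := lam)
    (P := fun mu q => 0 < Matrix.quadRe ((D.Ladj mu).1 (D.proj q.1)) q.2) (by
      rintro ⟨θ, u⟩ ⟨hθ, hu⟩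
      refine hc.continuousAt.eventually (lt_mem_nhds ?_)
      exact (hlam _ (D.proj θ).2).quadRe_pos (by
        rintro rfl
        simp at hu))
  filter_upwards [h] with mu hmu
  intro θ hθ
  refine ((D.Ladj mu).2.1 θ hθ).posDef_of_quadRe_pos fun x hx => ?_
  have := hmu (θ, x) ⟨hθ, hx⟩
  simpa only [D.proj_of_mem hθ] using this

end MomentKernel

/-! ### Norms compatible with the given topologies -/

section Norms

/-- The `L∞`-operator norm on square complex matrices, for the product uniformity. -/
abbrev Matrix.opNormedRing (m : ℕ) : NormedRing (Matrix (Fin m) (Fin m) ℂ) :=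
  { Matrix.linftyOpNormedRing with
    toMetricSpace := (Matrix.linftyOpNormedRing
      (n := Fin m) (α := ℂ)).toMetricSpace.replaceUniformity (U := Matrix.instUniformSpace _ _ _) rfl }

attribute [local instance] Matrix.opNormedRing

/-- Square complex matrices with the operator norm form a normed algebra. -/
abbrev Matrix.opNormedAlgebra (m : ℕ) : NormedAlgebra ℝ (Matrix (Fin m) (Fin m) ℂ) :=
  { (Matrix.linftyOpNormedAlgebra : NormedAlgebra ℝ (Matrix (Fin m) (Fin m) ℂ)) with }

attribute [local instance] Matrix.opNormedAlgebra

end Norms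

namespace MomentKernel

section

variable {m nl nr : ℕ} (D : MomentKernel m nl nr)

/-- The maximum norm on the moment space, for its given topology. -/
abbrev momNormedAddCommGroup : NormedAddCommGroup D.Mom :=
  let _ : NormedAddCommGroup (Matrix (Fin nl) (Fin nr) ℂ) := Matrix.normedAddCommGroup
  { (Submodule.normedAddCommGroup D.Mom : NormedAddCommGroup D.Mom) with
    toMetricSpace := (Submodule.normedAddCommGroup D.Mom :
      NormedAddCommGroup D.Mom).toMetricSpace.replaceTopology
        (U := instTopologicalSpaceSubtype) rfl }

attribute [local instance] momNormedAddCommGroup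

/-- The moment space with the maximum norm is a normed space. -/
abbrev momNormedSpace : NormedSpace ℝ D.Mom :=
  let _ : NormedAddCommGroup (Matrix (Fin nl) (Fin nr) ℂ) := Matrix.normedAddCommGroup
  let _ : NormedSpace ℝ (Matrix (Fin nl) (Fin nr) ℂ) := Matrix.normedSpace
  { (Submodule.normedSpace D.Mom : NormedSpace ℝ D.Mom) with }

theorem norm_sq_le_sqNorm (x : D.Mom) : ‖x‖ ^ 2 ≤ D.sqNorm x := by
  let _ : NormedAddCommGroup (Matrix (Fin nl) (Fin nr) ℂ) := Matrix.normedAddCommGroup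
  have h0 : 0 ≤ D.sqNorm x := by
    rw [sqNorm, reInner_self]
    positivity
  have h : ‖x.1‖ ≤ √(D.sqNorm x) := by
    rw [Matrix.norm_le_iff (Real.sqrt_nonneg _)]
    intro i j
    refine Real.le_sqrt_of_sq_le ?_
    rw [sqNorm, reInner_self]
    exact (Finset.single_le_sum (f := fun j => ‖x.1 i j‖ ^ 2) (fun _ _ => by positivity)
      (Finset.mem_univ j)).trans (Finset.single_le_sum (f := fun i => ∑ j, ‖x.1 i j‖ ^ 2)
        (fun _ _ => by positivity) (Finset.mem_univ i))
  have h2 : ‖x‖ ≤ √(D.sqNorm x) := h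
  calc ‖x‖ ^ 2 ≤ √(D.sqNorm x) ^ 2 := pow_le_pow_left₀ (norm_nonneg _) h2 2
    _ = D.sqNorm x := Real.sq_sqrt h0

end

/-! ### Differentiability of `h` -/

section

attribute [local instance] Matrix.opNormedRing Matrix.opNormedAlgebra momNormedAddCommGroup momNormedSpace

variable {m nl nr : ℕ} (D : MomentKernel m nl nr)

instance : CompactSpace D.S := isCompact_iff_compactSpace.1 D.isCompact_S

/-- The moment map on continuous matrix functions, through their Hermitian parts. -/
def contMoment : C(D.S, Matrix (Fin m) (Fin m) ℂ) →ₗ[ℝ] D.Mom where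
  toFun c := D.Lm ⟨fun θ => hermPart (c (D.proj θ)),
    D.mem_HermL2 ((continuous_hermPart.comp (c.continuous.comp D.continuous_proj)).continuousOn)
      fun _ _ => hermPart_isHermitian _⟩
  map_add' c d := by
    rw [← map_add]
    congr 1
    ext θ i j
    simp [hermPart]
    ring
  map_smul' r c := by
    rw [RingHom.id_apply, ← map_smul]
    congr 1
    ext θ i j
    simp [hermPart, Matrix.conjTranspose_smul]
    ring

theorem contMoment_eq {c : C(D.S, Matrix (Fin m) (Fin m) ℂ)} {ρ : D.HermL2}
    (h : ∀ θ : D.S, c θ = ρ.1 θ) : D.contMoment c = D.Lm ρ := by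
  refine Subtype.ext ?_
  ext i j
  refine setIntegral_congr_fun D.measurableSet_S fun θ hθ => ?_
  change (D.Gl θ * hermPart (c (D.proj θ)) * D.Gr θ) i j = (D.Gl θ * ρ.1 θ * D.Gr θ) i j
  rw [h, D.proj_of_mem hθ, hermPart_of_isHermitian (ρ.2.1 θ hθ)]

theorem continuous_contMoment : Continuous D.contMoment := by
  refine continuous_induced_rng.2 (continuous_pi fun i => continuous_pi fun j => ?_)
  have h1 : Continuous fun q : C(D.S, Matrix (Fin m) (Fin m) ℂ) × ℝ =>
      (D.Gl (D.proj q.2) * hermPart (q.1 (D.proj q.2)) * D.Gr (D.proj q.2)) i j := by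
    have h2 : Continuous fun q : C(D.S, Matrix (Fin m) (Fin m) ℂ) × ℝ => q.1 (D.proj q.2) :=
      continuous_eval.comp (continuous_fst.prodMk (D.continuous_proj.comp continuous_snd))
    exact (((D.continuous_Gl_proj.comp continuous_snd).matrix_mul
      (continuous_hermPart.comp h2)).matrix_mul
      (D.continuous_Gr_proj.comp continuous_snd)).matrix_elem i j
  have h3 : ∀ c : C(D.S, Matrix (Fin m) (Fin m) ℂ), (D.contMoment c).1 i j =
      ∫ θ in D.a..D.b,
        (D.Gl (D.proj θ) * hermPart (c (D.proj θ)) * D.Gr (D.proj θ)) i j := by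
    intro c
    rw [intervalIntegral.integral_of_le D.a_lt_b.le, ← integral_Icc_eq_integral_Ioc]
    refine setIntegral_congr_fun D.measurableSet_S fun θ hθ => ?_
    change (D.Gl θ * hermPart (c (D.proj θ)) * D.Gr θ) i j = _
    simp only [D.proj_of_mem hθ]
  change Continuous fun c => (D.contMoment c).1 i j
  simp only [h3]
  exact intervalIntegral.continuous_parametric_intervalIntegral_of_continuous' h1 _ _

/-- The adjoint moment map as a map to continuous matrix functions. -/
def contAdj : D.Mom →ₗ[ℝ] C(D.S, Matrix (Fin m) (Fin m) ℂ) where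
  toFun lam := ⟨fun θ => (D.Ladj lam).1 θ,
    continuousOn_iff_continuous_domRestrict.1 (D.continuousOn_Ladj lam)⟩
  map_add' x y := by
    ext1 θ
    exact congrFun (congrArg Subtype.val (map_add D.Ladj x y)) θ
  map_smul' r x := by
    ext1 θ
    exact congrFun (congrArg Subtype.val (map_smul D.Ladj r x)) θ

/-- The values of the adjoint moment map at a point of the interior of the dual cone, as a unit of
the ring of continuous matrix functions. -/
def unitAdj (lam : D.dualInt) : C(D.S, Matrix (Fin m) (Fin m) ℂ)ˣ where
  val := D.contAdj lam.1
  inv := ⟨fun θ => ((D.Ladj lam.1).1 θ)⁻¹,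
    continuousOn_iff_continuous_domRestrict.1 (D.continuousOn_Ladj_inv lam)⟩
  val_inv := ContinuousMap.ext fun θ =>
    Matrix.mul_nonsing_inv _ ((Matrix.isUnit_iff_isUnit_det _).1 (lam.2 θ θ.2).isUnit)
  inv_val := ContinuousMap.ext fun θ =>
    Matrix.nonsing_inv_mul _ ((Matrix.isUnit_iff_isUnit_det _).1 (lam.2 θ θ.2).isUnit)

/-- An extension of `h` to the whole moment space. -/
def hExt (lam : D.Mom) : D.Mom := D.contMoment (Ring.inverse (D.contAdj lam))

theorem hExt_coe (lam : D.dualInt) : D.hExt lam = D.h lam := by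
  have h1 : D.contAdj lam.1 = (D.unitAdj lam : C(D.S, Matrix (Fin m) (Fin m) ℂ)) := rfl
  rw [hExt, h1, Ring.inverse_unit]
  exact D.contMoment_eq fun _ => rfl

/-- The Jacobian of `h` as a continuous linear map. -/
def gradHL (lam : D.dualInt) : D.Mom →L[ℝ] D.Mom := LinearMap.toContinuousLinearMap (D.gradH lam)

/-- `hExt` is a continuous linear map after inversion in the Banach algebra of continuous matrix
functions after a linear map. Strictness is what the inverse function theorem needs. -/
theorem hasStrictFDerivAt_hExt (lam : D.dualInt) :
    HasStrictFDerivAt D.hExt (D.gradHL lam) lam.1 := by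
  let T : C(D.S, Matrix (Fin m) (Fin m) ℂ) →L[ℝ] D.Mom := ⟨D.contMoment, D.continuous_contMoment⟩
  let A : D.Mom →L[ℝ] C(D.S, Matrix (Fin m) (Fin m) ℂ) :=
    ⟨D.contAdj, D.contAdj.continuous_of_finiteDimensional⟩
  have h1 : HasStrictFDerivAt Ring.inverse _ (A lam.1) :=
    hasStrictFDerivAt_ringInverse (𝕜 := ℝ) (R := C(D.S, Matrix (Fin m) (Fin m) ℂ))
      (D.unitAdj lam)
  have h2 := T.hasStrictFDerivAt.comp lam.1 (h1.comp lam.1 A.hasStrictFDerivAt)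
  refine h2.congr_fderiv ?_
  ext1 δ
  change D.contMoment (-(((D.unitAdj lam)⁻¹ : C(D.S, Matrix (Fin m) (Fin m) ℂ)ˣ).1 *
    D.contAdj δ * ((D.unitAdj lam)⁻¹ : C(D.S, Matrix (Fin m) (Fin m) ℂ)ˣ).1)) =
    -(D.Lm (D.sandwich lam δ))
  rw [map_neg]
  congr 1
  exact D.contMoment_eq fun _ => rfl

theorem continuousAt_hExt (lam : D.dualInt) : ContinuousAt D.hExt lam.1 :=
  (D.hasStrictFDerivAt_hExt lam).hasFDerivAt.continuousAt

theorem hasDerivWithinAt_h {lam : ℝ → D.dualInt} {v : D.Mom} {s : Set ℝ} {t : ℝ}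
    (hl : HasDerivWithinAt (fun s => (lam s : D.Mom)) v s t) :
    HasDerivWithinAt (fun s => D.h (lam s)) (D.gradH (lam t) v) s t := by
  have h1 := (D.hasStrictFDerivAt_hExt (lam t)).hasFDerivAt.comp_hasDerivWithinAt t hl
  have h2 : (D.hExt ∘ fun s => (lam s : D.Mom)) = fun s => D.h (lam s) :=
    funext fun s => D.hExt_coe (lam s)
  rwa [h2] at h1

end

end MomentKernel

/-! ### Behaviour of `h` at the boundary of the dual cone -/

theorem lintegral_inv_ofReal_le_of_tendsto {μ : Measure ℝ} {f : ℕ → ℝ → ℝ} {g : ℝ → ℝ}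
    (hf : ∀ n, Measurable (f n)) (hfg : ∀ θ, Tendsto (fun n => f n θ) atTop (𝓝 (g θ)))
    {u : ℕ → ENNReal} {C : ENNReal} (hu : Tendsto u atTop (𝓝 C))
    (hle : ∀ n, ∫⁻ θ, (ENNReal.ofReal (f n θ))⁻¹ ∂μ ≤ u n) :
    ∫⁻ θ, (ENNReal.ofReal (g θ))⁻¹ ∂μ ≤ C := by
  -- Inversion is continuous on `[0, ∞]`, also at `0`, so no positivity of the limit `g` is needed.
  have hpt : ∀ θ, liminf (fun n => (ENNReal.ofReal (f n θ))⁻¹) atTop = (ENNReal.ofReal (g θ))⁻¹ :=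
    fun θ => Tendsto.liminf_eq (tendsto_inv_iff.2 (ENNReal.tendsto_ofReal (hfg θ)))
  calc ∫⁻ θ, (ENNReal.ofReal (g θ))⁻¹ ∂μ
      = ∫⁻ θ, liminf (fun n => (ENNReal.ofReal (f n θ))⁻¹) atTop ∂μ :=
        lintegral_congr fun θ => (hpt θ).symm
    _ ≤ liminf (fun n => ∫⁻ θ, (ENNReal.ofReal (f n θ))⁻¹ ∂μ) atTop :=
        lintegral_liminf_le fun n => (ENNReal.measurable_ofReal.comp (hf n)).inv
    _ ≤ liminf u atTop := liminf_le_liminf (Eventually.of_forall hle)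
    _ = C := hu.liminf_eq

namespace MomentKernel

variable {m nl nr : ℕ} (D : MomentKernel m nl nr)

theorem contDiffOn_quadRe_Ladj (lam : D.Mom) (x : Fin m → ℂ) :
    ContDiffOn ℝ 1 (fun θ => Matrix.quadRe ((D.Ladj lam).1 θ) x) D.S := by
  have h0 : (fun θ => Matrix.quadRe ((D.Ladj lam).1 θ) x) =
      fun θ => Matrix.quadRe ((D.Gl θ)ᴴ * lam.1 * (D.Gr θ)ᴴ) x :=
    funext fun θ => Matrix.quadRe_hermPart _ x
  rw [h0]
  simp only [Matrix.quadRe, dotProduct, Matrix.mulVec, Matrix.mul_apply,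
    Matrix.conjTranspose_apply]
  have hl : ∀ i j, ContDiffOn ℝ 1 (fun θ => star (D.Gl θ i j)) D.S := fun i j =>
    Complex.conjCLE.contDiff.comp_contDiffOn (D.contDiffOn_Gl i j)
  have hr : ∀ i j, ContDiffOn ℝ 1 (fun θ => star (D.Gr θ i j)) D.S := fun i j =>
    Complex.conjCLE.contDiff.comp_contDiffOn (D.contDiffOn_Gr i j)
  refine Complex.reCLM.contDiff.comp_contDiffOn (ContDiffOn.sum fun i _ =>
    contDiffOn_const.mul (ContDiffOn.sum fun j _ => ContDiffOn.mul (ContDiffOn.sum fun k _ =>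
      ContDiffOn.mul (ContDiffOn.sum fun l _ => (hl _ _).mul contDiffOn_const) (hr _ _))
      contDiffOn_const))

/-- In one dimension `1 / |θ - θ₀|` is not integrable over an interval containing `θ₀`, even as an
endpoint. -/
theorem lintegral_inv_eq_top_of_le_mul_abs {f : ℝ → ℝ} {K θ₀ : ℝ} (hθ₀ : θ₀ ∈ D.S)
    (hf : ∀ θ ∈ D.S, f θ ≤ K * |θ - θ₀|) :
    ∫⁻ θ in D.S, (ENNReal.ofReal (f θ))⁻¹ = ⊤ := by
  by_contra hne
  set K' := max K 1
  have hK' : 0 < K' := lt_of_lt_of_le one_pos (le_max_right _ _)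
  have hi : IntegrableOn (fun θ : ℝ => (θ - θ₀)⁻¹) D.S := by
    refine ⟨(measurable_id.sub_const θ₀).inv.aestronglyMeasurable, ?_⟩
    rw [hasFiniteIntegral_def]
    have hle : ∀ θ ∈ D.S,
        ‖(θ - θ₀)⁻¹‖ₑ ≤ ENNReal.ofReal K' * (ENNReal.ofReal (f θ))⁻¹ := by
      intro θ hθ
      rcases eq_or_ne θ θ₀ with rfl | hn
      · simp
      · have hp : 0 < |θ - θ₀| := abs_pos.2 (sub_ne_zero.2 hn)
        have h1 : f θ ≤ K' * |θ - θ₀| :=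
          (hf θ hθ).trans (mul_le_mul_of_nonneg_right (le_max_left _ _) hp.le)
        calc ‖(θ - θ₀)⁻¹‖ₑ = ENNReal.ofReal (K' * (K' * |θ - θ₀|)⁻¹) := by
              rw [← ofReal_norm, norm_inv, Real.norm_eq_abs]
              congr 1
              field_simp
          _ = ENNReal.ofReal K' * (ENNReal.ofReal (K' * |θ - θ₀|))⁻¹ := by
              rw [ENNReal.ofReal_mul hK'.le, ENNReal.ofReal_inv_of_pos (by positivity)]
          _ ≤ _ := by gcongr
    calc ∫⁻ θ in D.S, ‖(θ - θ₀)⁻¹‖ₑ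
        ≤ ∫⁻ θ in D.S, ENNReal.ofReal K' * (ENNReal.ofReal (f θ))⁻¹ :=
          setLIntegral_mono' D.measurableSet_S hle
      _ = ENNReal.ofReal K' * ∫⁻ θ in D.S, (ENNReal.ofReal (f θ))⁻¹ :=
          lintegral_const_mul' _ _ ENNReal.ofReal_ne_top
      _ < ⊤ := ENNReal.mul_lt_top ENNReal.ofReal_lt_top (lt_top_iff_ne_top.2 hne)
  have h2 := (intervalIntegrable_iff_integrableOn_Icc_of_le D.a_lt_b.le).2 hi
  rcases intervalIntegrable_sub_inv_iff.1 h2 with h3 | h3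
  · exact D.a_lt_b.ne h3
  · rw [uIcc_of_le D.a_lt_b.le] at h3
    exact h3 hθ₀

/-- The integral of the reciprocal of the Hermitian form of `L* λ` is controlled by `h λ`. -/
theorem lintegral_inv_quadRe_le (mu : D.dualInt) {x : Fin m → ℂ} (hx : x ≠ 0) :
    ∃ c : ℝ, 0 ≤ c ∧ ∀ lam : D.dualInt,
      ∫⁻ θ in D.S, (ENNReal.ofReal (Matrix.quadRe ((D.Ladj lam.1).1 θ) x))⁻¹ ≤
        ENNReal.ofReal (c * reInner mu.1.1 (D.h lam).1) := by
  have hq : Continuous fun A : Matrix (Fin m) (Fin m) ℂ => Matrix.quadRe A x :=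
    Matrix.continuous_quadRe.comp (continuous_id.prodMk continuous_const)
  obtain ⟨C, hC⟩ := D.isCompact_S.exists_bound_of_continuousOn
    (hq.comp_continuousOn (D.continuousOn_Ladj_inv mu))
  have hN : 0 < (star x ⬝ᵥ x).re := by
    have := (Matrix.PosDef.one (n := Fin m) (R := ℂ)).quadRe_pos hx
    simpa [Matrix.quadRe] using this
  set N := (star x ⬝ᵥ x).re
  -- With `C` bounding the form of `(L* μ)⁻¹` at `x` and `ρ = (L* λ)⁻¹`, the chain is `N² / (x* (L*
  -- λ) x) ≤ x* ρ x ≤ max C 0 * tr ((L* μ) ρ)`; the last trace integrates to `⟨μ, h λ⟩`.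
  refine ⟨max C 0 / N ^ 2, by positivity, fun lam => ?_⟩
  have hle : ∀ θ ∈ D.S, (ENNReal.ofReal (Matrix.quadRe ((D.Ladj lam.1).1 θ) x))⁻¹ ≤
      ENNReal.ofReal (max C 0 / N ^ 2 *
        (((D.Ladj mu.1).1 θ * (D.ratDensity lam).1 θ).trace).re) := by
    intro θ hθ
    have hA := lam.2 θ hθ
    have hp := hA.quadRe_pos hx
    have hQ := (D.ratDensity_posDef lam hθ).posSemidef
    rw [← ENNReal.ofReal_inv_of_pos hp]
    refine ENNReal.ofReal_le_ofReal ?_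
    have h1 := hA.sq_le_quadRe_mul_quadRe_inv x
    have h2 := (mu.2 θ hθ).quadRe_le_quadRe_inv_mul hQ x
    have h3 : Matrix.quadRe ((D.Ladj mu.1).1 θ)⁻¹ x ≤ max C 0 :=
      (le_abs_self _).trans ((hC θ hθ).trans (le_max_left _ _))
    have h4 := (mu.2 θ hθ).posSemidef.re_trace_mul_nonneg hQ
    have h5 := h2.trans (mul_le_mul_of_nonneg_right h3 h4)
    change Matrix.quadRe ((D.Ladj lam.1).1 θ)⁻¹ x ≤ _ at h5
    rw [div_mul_eq_mul_div, le_div_iff₀ (by positivity), inv_mul_le_iff₀ hp]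
    exact h1.trans (mul_le_mul_of_nonneg_left h5 hp.le)
  refine (setLIntegral_mono' D.measurableSet_S hle).trans ?_
  have hi := (D.integrable_re_trace_Ladj_mul mu.1 (D.ratDensity lam)).const_mul (max C 0 / N ^ 2)
  rw [h, reInner_Lm, ← integral_const_mul, ofReal_integral_eq_lintegral_ofReal hi]
  filter_upwards [ae_restrict_mem D.measurableSet_S] with θ hθ
  exact mul_nonneg (by positivity) ((mu.2 θ hθ).posSemidef.re_trace_mul_nonneg
    (D.ratDensity_posDef lam hθ).posSemidef)

theorem continuous_quadRe_Ladj_proj (x : Fin m → ℂ) :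
    Continuous fun q : D.Mom × ℝ => Matrix.quadRe ((D.Ladj q.1).1 (D.proj q.2)) x :=
  Matrix.continuous_quadRe.comp (D.continuous_Ladj_proj.prodMk continuous_const)

theorem continuous_reInner_coe (lam : D.Mom) : Continuous fun k : D.Mom => reInner lam.1 k.1 :=
  (continuous_reInner _).comp continuous_subtype_val

theorem lintegral_inv_quadRe_proj (mu : D.Mom) (x : Fin m → ℂ) :
    ∫⁻ θ in D.S, (ENNReal.ofReal (Matrix.quadRe ((D.Ladj mu).1 (D.proj θ)) x))⁻¹ =
      ∫⁻ θ in D.S, (ENNReal.ofReal (Matrix.quadRe ((D.Ladj mu).1 θ) x))⁻¹ :=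
  setLIntegral_congr_fun D.measurableSet_S fun θ hθ => by
    rw [D.proj_of_mem hθ]

/-- Fatou's lemma for the reciprocals of the Hermitian forms. -/
theorem lintegral_inv_quadRe_le_of_tendsto {l : ℕ → D.Mom} {lam : D.Mom} (x : Fin m → ℂ)
    (hl : Tendsto l atTop (𝓝 lam)) {u : ℕ → ENNReal} {C : ENNReal} (hu : Tendsto u atTop (𝓝 C))
    (hle : ∀ n, ∫⁻ θ in D.S, (ENNReal.ofReal (Matrix.quadRe ((D.Ladj (l n)).1 θ) x))⁻¹ ≤ u n) :
    ∫⁻ θ in D.S, (ENNReal.ofReal (Matrix.quadRe ((D.Ladj lam).1 θ) x))⁻¹ ≤ C := by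
  have hq := D.continuous_quadRe_Ladj_proj x
  rw [← lintegral_inv_quadRe_proj]
  refine lintegral_inv_ofReal_le_of_tendsto
    (f := fun n θ => Matrix.quadRe ((D.Ladj (l n)).1 (D.proj θ)) x) (fun n => ?_) (fun θ => ?_)
    hu fun n => ?_
  · have h1 := hq.comp (Continuous.prodMk_right (l n) : Continuous fun θ : ℝ => (l n, θ))
    exact h1.measurable
  · have h1 := (hq.tendsto (lam, θ)).comp (hl.prodMk_nhds (tendsto_const_nhds (x := θ)))
    exact h1
  · rw [lintegral_inv_quadRe_proj]
    exact hle n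

/-- A bounded limit of points along which `h` converges stays in the interior of the dual cone. -/
theorem mem_dualInt_of_tendsto {l : ℕ → D.dualInt} {lam y : D.Mom}
    (hl : Tendsto (fun n => (l n : D.Mom)) atTop (𝓝 lam))
    (hy : Tendsto (fun n => D.h (l n)) atTop (𝓝 y)) : lam ∈ D.dualInt := by
  by_contra hlam
  rw [mem_dualInt_iff] at hlam
  push Not at hlam
  obtain ⟨θ₀, hθ₀, hnp⟩ := hlam
  have hx : ∃ x ∈ Metric.sphere (0 : Fin m → ℂ) 1, Matrix.quadRe ((D.Ladj lam).1 θ₀) x ≤ 0 := by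
    by_contra hcon
    push Not at hcon
    exact hnp (((D.Ladj lam).2.1 θ₀ hθ₀).posDef_of_quadRe_pos hcon)
  obtain ⟨x, hxs, hx0⟩ := hx
  have hxne : x ≠ 0 := by
    rintro rfl
    simp at hxs
  -- Continuous differentiability of the kernels enters here: the form is Lipschitz and nonpositive
  -- at `θ₀`.
  obtain ⟨K, hK⟩ := (D.contDiffOn_quadRe_Ladj lam x).exists_lipschitzOnWith one_ne_zero
    (convex_Icc _ _) isCompact_Icc
  have htop := D.lintegral_inv_eq_top_of_le_mul_abs
    (f := fun θ => Matrix.quadRe ((D.Ladj lam).1 θ) x) (K := K) hθ₀ fun θ hθ => by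
      have h1 := hK.dist_le_mul θ hθ θ₀ hθ₀
      rw [Real.dist_eq, Real.dist_eq] at h1
      linarith [le_abs_self (Matrix.quadRe ((D.Ladj lam).1 θ) x -
        Matrix.quadRe ((D.Ladj lam).1 θ₀) x)]
  -- Any fixed point of `dualInt` serves as the reference weight; `l 0` is at hand.
  obtain ⟨c, -, hle⟩ := D.lintegral_inv_quadRe_le (l 0) hxne
  have hlim := ENNReal.tendsto_ofReal
    ((((D.continuous_reInner_coe (l 0).1).tendsto y).comp hy).const_mul c)
  have h2 := D.lintegral_inv_quadRe_le_of_tendsto x hl hlim fun n => hle (l n)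
  rw [htop, top_le_iff] at h2
  exact ENNReal.ofReal_ne_top h2

/-! ### The range of `h` is the interior of the moment cone -/

theorem convex_K : Convex ℝ D.K := by
  refine Convex.closure (Convex.linear_image ?_ _)
  intro ρ hρ σ hσ s t hs ht _ θ hθ
  have h1 := (hρ θ hθ).smul (α := ℝ) hs
  have h2 := (hσ θ hθ).smul (α := ℝ) ht
  exact h1.add h2

theorem reInner_nonneg_of_mem_K (lam : D.dualInt) {k : D.Mom} (hk : k ∈ D.K) :
    0 ≤ reInner lam.1.1 k.1 := by
  have hc : IsClosed {k : D.Mom | 0 ≤ reInner lam.1.1 k.1} :=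
    isClosed_le continuous_const ((continuous_reInner _).comp continuous_subtype_val)
  refine closure_minimal ?_ hc hk
  rintro _ ⟨ρ, hρ, rfl⟩
  change 0 ≤ reInner lam.1.1 (D.Lm ρ).1
  rw [reInner_Lm]
  exact setIntegral_nonneg D.measurableSet_S fun θ hθ =>
    (lam.2 θ hθ).posSemidef.re_trace_mul_nonneg (hρ θ hθ)

/-- The integrand is the trace of the identity. That this pairing does not depend on `lam` bounds
`lam` over compact parts of `interior K` and cancels the linear term in the entropy comparison. -/
theorem reInner_self_h (lam : D.dualInt) :
    reInner lam.1.1 (D.h lam).1 = ∫ _ in D.S, (m : ℝ) := by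
  rw [reInner_h]
  refine setIntegral_congr_fun D.measurableSet_S fun θ hθ => ?_
  simp [Matrix.mul_nonsing_inv _ ((Matrix.isUnit_iff_isUnit_det _).1 (lam.2 θ hθ).isUnit)]

section

attribute [local instance] momNormedAddCommGroup momNormedSpace

theorem exists_localInverse_h (lam : D.dualInt) :
    ∃ (G : D.Mom → D.Mom) (G' : D.Mom →L[ℝ] D.Mom), HasFDerivAt G G' (D.h lam) ∧
      (∀ v, G' v = Ring.inverse (D.gradH lam) v) ∧
      ∀ᶠ y in 𝓝 (D.h lam), ∃ mu : D.dualInt, (mu : D.Mom) = G y ∧ D.h mu = y := by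
  have hu := D.isUnit_gradH lam
  let e : D.Mom ≃L[ℝ] D.Mom :=
    (LinearEquiv.ofBijective (D.gradH lam) ((Module.End.isUnit_iff _).1 hu)).toContinuousLinearEquiv
  have hf : HasStrictFDerivAt D.hExt (e : D.Mom →L[ℝ] D.Mom) lam.1 :=
    (D.hasStrictFDerivAt_hExt lam).congr_fderiv (by ext1 v; rfl)
  have hG := hf.to_localInverse
  have hr := hf.eventually_right_inverse
  have hc := hf.localInverse_continuousAt
  have h0 := hf.localInverse_apply_image
  rw [D.hExt_coe lam] at hG hr hc h0
  refine ⟨_, _, hG.hasFDerivAt, fun v => ?_, ?_⟩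
  · change e.symm v = _
    rw [ContinuousLinearEquiv.symm_apply_eq]
    change v = (D.gradH lam * Ring.inverse (D.gradH lam)) v
    rw [Ring.mul_inverse_cancel _ hu]
    rfl
  · have hU := hc.eventually_mem (s := D.dualInt)
      (D.isOpen_dualInt.mem_nhds (by rw [h0]; exact lam.2))
    filter_upwards [hr, hU] with y hy1 hy2
    exact ⟨⟨_, hy2⟩, rfl, by rw [← D.hExt_coe]; exact hy1⟩

theorem isOpen_range_h : IsOpen (range D.h) := by
  rw [isOpen_iff_mem_nhds]
  rintro _ ⟨lam, rfl⟩
  obtain ⟨G, G', -, -, h⟩ := D.exists_localInverse_h lam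
  filter_upwards [h] with y hy
  obtain ⟨mu, -, hmu⟩ := hy
  exact ⟨mu, hmu⟩

theorem range_h_subset_interior_K : range D.h ⊆ interior D.K := by
  refine D.isOpen_range_h.subset_interior_iff.2 ?_
  rintro _ ⟨lam, rfl⟩
  exact subset_closure ⟨D.ratDensity lam, fun θ hθ => (D.ratDensity_posDef lam hθ).posSemidef, rfl⟩

/-- Injectivity makes the global inverse agree with the local one near `h lam`. -/
theorem hasFDerivAt_invFun_h [Nonempty D.dualInt] (lam : D.dualInt) :
    ∃ G' : D.Mom →L[ℝ] D.Mom,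
      HasFDerivAt (fun y => ((Function.invFun D.h y : D.dualInt) : D.Mom)) G' (D.h lam) ∧
      ∀ v, G' v = Ring.inverse (D.gradH lam) v := by
  obtain ⟨G, G', hG, hG', h⟩ := D.exists_localInverse_h lam
  refine ⟨G', hG.congr_of_eventuallyEq ?_, hG'⟩
  filter_upwards [h] with y hy
  obtain ⟨mu, h1, h2⟩ := hy
  rw [← h1, ← h2, Function.leftInverse_invFun D.h_injective mu]

/-- Where `h` converges to a value that it does not take, its argument is unbounded. -/
theorem tendsto_sqNorm_atTop {ι : Type*} {F : Filter ι} [F.IsCountablyGenerated]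
    {lam : ι → D.dualInt} {y : D.Mom} (hy : Tendsto (fun t => D.h (lam t)) F (𝓝 y))
    (hny : y ∉ range D.h) : Tendsto (fun t => D.sqNorm (lam t : D.Mom)) F atTop := by
  by_contra hnot
  rw [tendsto_atTop] at hnot
  push Not at hnot
  obtain ⟨M, hM⟩ := hnot
  obtain ⟨t, ht, htM⟩ := exists_seq_forall_of_frequently hM
  have : ProperSpace D.Mom := FiniteDimensional.proper ℝ _
  have hb : ∀ n, (lam (t n) : D.Mom) ∈ Metric.closedBall (0 : D.Mom) √M := fun n => by
    rw [mem_closedBall_zero_iff]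
    exact Real.le_sqrt_of_sq_le ((D.norm_sq_le_sqNorm _).trans (htM n).le)
  -- A bounded subsequence would converge to a point of `dualInt`, where continuity of `h` would put
  -- `y` in the range.
  obtain ⟨lamS, -, φ, hφ, hlim⟩ := (isCompact_closedBall _ _).tendsto_subseq hb
  have hy' : Tendsto (fun n => D.h (lam (t (φ n)))) atTop (𝓝 y) :=
    hy.comp (ht.comp hφ.tendsto_atTop)
  have hmem := D.mem_dualInt_of_tendsto (l := fun n => lam (t (φ n))) hlim hy'
  have h1 := (D.continuousAt_hExt ⟨lamS, hmem⟩).tendsto.comp hlim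
  have h2 : (D.hExt ∘ (fun n => (lam (t n) : D.Mom)) ∘ φ) = fun n => D.h (lam (t (φ n))) :=
    funext fun n => D.hExt_coe _
  rw [h2, D.hExt_coe ⟨lamS, hmem⟩] at h1
  exact hny ⟨_, tendsto_nhds_unique h1 hy'⟩

/-- The convex set `interior K` is connected and `range h` is open, so it remains to show that the
range is relatively closed. -/
theorem range_h_eq_interior_K (hne : D.dualInt.Nonempty) : range D.h = interior D.K := by
  refine (range_h_subset_interior_K D).antisymm ?_
  have : Nonempty D.dualInt := hne.to_subtype
  obtain ⟨lam₀⟩ := this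
  refine D.convex_K.interior.isPreconnected.subset_of_closure_inter_subset D.isOpen_range_h
    ⟨D.h lam₀, range_h_subset_interior_K D ⟨lam₀, rfl⟩, lam₀, rfl⟩ ?_
  rintro y ⟨hyc, hyK⟩
  by_contra hny
  obtain ⟨z, hz, hzy⟩ := mem_closure_iff_seq_limit.1 hyc
  choose l hl using hz
  have hly : Tendsto (fun n => D.h (l n)) atTop (𝓝 y) := by simpa only [hl] using hzy
  have hinf := D.tendsto_sqNorm_atTop hly hny
  obtain ⟨r, hr, hball⟩ := Metric.mem_nhds_iff.1 (mem_interior_iff_mem_nhds.1 hyK)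
  set C : ℝ := ∫ _ in D.S, (m : ℝ)
  have hC : 0 ≤ C := setIntegral_nonneg D.measurableSet_S fun _ _ => Nat.cast_nonneg _
  -- The threshold is the bound on `‖l n‖²` that the pairing with the shifted point below yields, so
  -- exceeding it is contradictory.
  have hev := (hly.eventually (Metric.ball_mem_nhds y (half_pos hr))).and
    (hinf.eventually_gt_atTop ((2 / (r / 2)) * (C + C ^ 2 / (2 * (r / 2)))))
  obtain ⟨n, hn1, hn2⟩ := hev.exists
  set s := r / 2
  have hs : 0 < s := half_pos hr
  -- A shift along `-l n` of length below `s` stays in the ball around `y`, yet lowers the pairing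
  -- with `l n` from its constant value `C` by a term of order `‖l n‖`.
  have hw : D.h (l n) - (s / (‖(l n).1‖ + 1)) • (l n).1 ∈ D.K := by
    refine hball ?_
    rw [mem_ball_iff_norm]
    rw [dist_eq_norm] at hn1
    have h1 : ‖(s / (‖(l n).1‖ + 1)) • (l n).1‖ < s := by
      rw [norm_smul, Real.norm_of_nonneg (by positivity), div_mul_eq_mul_div, div_lt_iff₀
        (by positivity)]
      nlinarith
    calc ‖D.h (l n) - (s / (‖(l n).1‖ + 1)) • (l n).1 - y‖
        = ‖(D.h (l n) - y) - (s / (‖(l n).1‖ + 1)) • (l n).1‖ := by congr 1; abel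
      _ ≤ ‖D.h (l n) - y‖ + ‖(s / (‖(l n).1‖ + 1)) • (l n).1‖ := norm_sub_le _ _
      _ < s + s := add_lt_add hn1 h1
      _ = r := add_halves r
  have h3 := D.reInner_nonneg_of_mem_K (l n) hw
  have h4 : reInner (l n).1.1 (D.h (l n) - (s / (‖(l n).1‖ + 1)) • (l n).1 : D.Mom).1 =
      C - s / (‖(l n).1‖ + 1) * D.sqNorm (l n).1 := by
    change reInner (l n).1.1 ((D.h (l n)).1 - (s / (‖(l n).1‖ + 1)) • (l n).1.1) = _
    rw [reInner_sub_right, reInner_smul_right, reInner_self_h]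
    rfl
  rw [h4, sub_nonneg, div_mul_eq_mul_div, div_le_iff₀ (by positivity)] at h3
  have h5 := D.norm_sq_le_sqNorm (l n).1
  have h6 : C * ‖(l n).1‖ ≤ s / 2 * D.sqNorm (l n).1 + C ^ 2 / (2 * s) := by
    have h7 : C * ‖(l n).1‖ ≤ s / 2 * ‖(l n).1‖ ^ 2 + C ^ 2 / (2 * s) := by
      have h8 : s / 2 * ‖(l n).1‖ ^ 2 + C ^ 2 / (2 * s) - C * ‖(l n).1‖ =
          (s * ‖(l n).1‖ - C) ^ 2 / (2 * s) := by
        field_simp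
        ring
      have h9 : 0 ≤ (s * ‖(l n).1‖ - C) ^ 2 / (2 * s) := by positivity
      linarith
    have h10 := mul_le_mul_of_nonneg_left h5 (half_pos hs).le
    linarith
  rw [div_mul_eq_mul_div, div_lt_iff₀ hs] at hn2
  linarith

end

end MomentKernel

/-! ### Entropy minimization -/

namespace MomentKernel

variable {m nl nr : ℕ} (D : MomentKernel m nl nr)

theorem traceLog_eq {ρ : D.HermL2} (hρ : ρ ∈ D.posCone) {θ : ℝ} (hθ : θ ∈ D.S) :
    D.traceLog ρ θ = Real.log (ρ.1 θ).det.re :=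
  Matrix.trace_cfc_log (hρ θ hθ)

theorem ratDensity_mem_posCone (lam : D.dualInt) : D.ratDensity lam ∈ D.posCone :=
  fun _ hθ => D.ratDensity_posDef lam hθ

theorem inv_ratDensity (lam : D.dualInt) {θ : ℝ} (hθ : θ ∈ D.S) :
    ((D.ratDensity lam).1 θ)⁻¹ = (D.Ladj lam.1).1 θ :=
  Matrix.nonsing_inv_nonsing_inv _ ((Matrix.isUnit_iff_isUnit_det _).1 (lam.2 θ hθ).isUnit)

theorem integrableOn_traceLog_ratDensity (lam : D.dualInt) :
    IntegrableOn (D.traceLog (D.ratDensity lam)) D.S := by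
  have h1 : ContinuousOn (fun θ => Real.log ((D.ratDensity lam).1 θ).det.re) D.S := by
    refine ContinuousOn.log ?_ fun θ hθ =>
      (Complex.lt_def.1 (D.ratDensity_posDef lam hθ).det_pos).1.ne'
    have h2 : Continuous fun A : Matrix (Fin m) (Fin m) ℂ => A.det.re := by fun_prop
    exact h2.comp_continuousOn (D.continuousOn_Ladj_inv lam)
  exact (h1.integrableOn_compact D.isCompact_S).congr_fun
    (fun θ hθ => (D.traceLog_eq (D.ratDensity_mem_posCone lam) hθ).symm) D.measurableSet_S

/-- The gap in the tangent inequality of `log det` at the rational density. -/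
def tangentGap (lam : D.dualInt) (ρ : D.HermL2) (θ : ℝ) : ℝ :=
  (((D.Ladj lam.1).1 θ * ρ.1 θ).trace.re - m) -
    (D.traceLog ρ θ - D.traceLog (D.ratDensity lam) θ)

theorem tangentGap_nonneg (lam : D.dualInt) {ρ : D.HermL2} (hρ : ρ ∈ D.posCone) {θ : ℝ}
    (hθ : θ ∈ D.S) : 0 ≤ D.tangentGap lam ρ θ := by
  have := (hρ θ hθ).log_det_sub_le (D.ratDensity_posDef lam hθ)
  rw [D.inv_ratDensity lam hθ] at this
  rw [tangentGap, D.traceLog_eq hρ hθ, D.traceLog_eq (D.ratDensity_mem_posCone lam) hθ]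
  linarith

theorem eq_of_tangentGap_eq_zero (lam : D.dualInt) {ρ : D.HermL2} (hρ : ρ ∈ D.posCone) {θ : ℝ}
    (hθ : θ ∈ D.S) (h0 : D.tangentGap lam ρ θ = 0) : ρ.1 θ = (D.ratDensity lam).1 θ := by
  rw [tangentGap, D.traceLog_eq hρ hθ, D.traceLog_eq (D.ratDensity_mem_posCone lam) hθ,
    ← D.inv_ratDensity lam hθ] at h0
  exact (hρ θ hθ).eq_of_log_det_sub_eq (D.ratDensity_posDef lam hθ) (by linarith)

/-- Both densities have the same moment, so the integral of `tr ((L* λ) ρ)` equals `⟨λ, h λ⟩`, the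
integral of `m`: the linear part cancels. -/
theorem integral_tangentGap (lam : D.dualInt) {ρ : D.HermL2} (hρ : D.Lm ρ = D.h lam)
    (hi : IntegrableOn (D.traceLog ρ) D.S) :
    IntegrableOn (D.tangentGap lam ρ) D.S ∧ ∫ θ in D.S, D.tangentGap lam ρ θ =
      (∫ θ in D.S, D.traceLog (D.ratDensity lam) θ) - ∫ θ in D.S, D.traceLog ρ θ := by
  have h1 := D.integrable_re_trace_Ladj_mul lam.1 ρ
  have h2 : Integrable (fun _ => (m : ℝ)) (volume.restrict D.S) := integrable_const _
  have h3 := D.integrableOn_traceLog_ratDensity lam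
  refine ⟨(h1.sub h2).sub (hi.sub h3), ?_⟩
  have h4 : ∫ θ in D.S, (((D.Ladj lam.1).1 θ * ρ.1 θ).trace).re = ∫ _ in D.S, (m : ℝ) := by
    rw [← reInner_Lm, hρ, reInner_self_h]
  have h5 := integral_sub (h1.sub h2) (hi.sub h3)
  have h6 := integral_sub h1 h2
  have h7 := integral_sub hi h3
  have h8 : ∫ θ in D.S, D.tangentGap lam ρ θ =
      (∫ θ in D.S, ((((D.Ladj lam.1).1 θ * ρ.1 θ).trace).re - m)) -
        ∫ θ in D.S, (D.traceLog ρ θ - D.traceLog (D.ratDensity lam) θ) := h5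
  rw [h8, h6, h7, h4]
  ring

theorem isMinimizer_ratDensity (lam : D.dualInt) :
    D.IsMinimizer (D.h lam) (D.ratDensity lam) := by
  refine ⟨⟨D.ratDensity_mem_posCone lam, rfl⟩, fun σ hσ => ?_⟩
  rw [entropy, if_pos (D.integrableOn_traceLog_ratDensity lam), entropy]
  split_ifs with hi
  · have h1 := (D.integral_tangentGap lam hσ.2 hi).2
    have h2 := setIntegral_nonneg (μ := volume) D.measurableSet_S
      fun θ hθ => D.tangentGap_nonneg lam hσ.1 hθ
    rw [EReal.coe_le_coe_iff]
    linarith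
  · exact le_top

theorem ae_eq_of_isMinimizer {lam : D.dualInt} {ρ : D.HermL2} (hρ : D.IsMinimizer (D.h lam) ρ) :
    ∀ᵐ θ ∂(volume.restrict D.S), ρ.1 θ = (D.ratDensity lam).1 θ := by
  have hle := hρ.2 _ (D.isMinimizer_ratDensity lam).1
  rw [entropy, entropy, if_pos (D.integrableOn_traceLog_ratDensity lam)] at hle
  split_ifs at hle with hi
  · obtain ⟨hgi, hge⟩ := D.integral_tangentGap lam hρ.1.2 hi
    have hn : 0 ≤ᵐ[volume.restrict D.S] D.tangentGap lam ρ := by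
      filter_upwards [ae_restrict_mem D.measurableSet_S] with θ hθ
      exact D.tangentGap_nonneg lam hρ.1.1 hθ
    rw [EReal.coe_le_coe_iff] at hle
    have h0 : ∫ θ in D.S, D.tangentGap lam ρ θ = 0 :=
      le_antisymm (by linarith) (integral_nonneg_of_ae hn)
    filter_upwards [(integral_eq_zero_iff_of_nonneg_ae hn hgi).1 h0,
      ae_restrict_mem D.measurableSet_S] with θ h1 hθ
    exact D.eq_of_tangentGap_eq_zero lam hρ.1.1 hθ h1
  -- A minimizer of infinite entropy is impossible, as the rational density has finite entropy.
  · exact absurd hle (by simp)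

/-! ### The differential equation and its flow -/

section

attribute [local instance] momNormedAddCommGroup momNormedSpace

theorem hasDerivAt_h {lam : ℝ → D.dualInt} {v : D.Mom} {t : ℝ}
    (hl : HasDerivAt (fun s => (lam s : D.Mom)) v t) :
    HasDerivAt (fun s => D.h (lam s)) (D.gradH (lam t) v) t :=
  (D.hasDerivWithinAt_h hl.hasDerivWithinAt).hasDerivAt univ_mem

theorem gradH_vectorField (R : D.Mom) (lam : D.dualInt) :
    D.gradH lam (D.vectorField R lam) = R - D.h lam := by
  change (D.gradH lam * Ring.inverse (D.gradH lam)) (R - D.h lam) = _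
  rw [Ring.mul_inverse_cancel _ (D.isUnit_gradH lam)]
  rfl

/-- Along a solution, `h` relaxes exponentially to `R`. -/
theorem IsSolution.h_eq {R : D.Mom} {T : ℝ} {lam : ℝ → D.dualInt}
    (hs : D.IsSolution R (Ico 0 T) lam) {t : ℝ} (ht : t ∈ Ico 0 T) :
    Real.exp t • (D.h (lam t) - R) = D.h (lam 0) - R := by
  have hd : ∀ x ∈ Ico 0 T,
      HasDerivWithinAt (fun s => Real.exp s • (D.h (lam s) - R)) 0 (Ico 0 T) x := by
    intro x hx
    have h1 := (D.hasDerivWithinAt_h (hs x hx)).sub_const R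
    rw [gradH_vectorField] at h1
    have h2 := (Real.hasDerivAt_exp x).hasDerivWithinAt (s := Ico 0 T) |>.smul h1
    refine h2.congr_deriv ?_
    rw [← smul_add]
    simp
  have hsub : Icc 0 t ⊆ Ico 0 T := fun s hs => ⟨hs.1, hs.2.trans_lt ht.2⟩
  -- Since `h λ` satisfies `y' = R - y`, the factor `exp t` makes the right derivative vanish on
  -- `[0, t]`.
  have h := constant_of_has_deriv_right_zero
    (fun x hx => (hd x (hsub hx)).continuousWithinAt.mono hsub)
    (fun x hx => (hd x (hsub (Ico_subset_Icc_self hx))).mono_of_mem_nhdsWithin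
      (mem_of_superset (Ico_mem_nhdsGE (hsub (Ico_subset_Icc_self hx)).2)
        (Ico_subset_Ico_left hx.1))) t ⟨ht.1, le_rfl⟩
  simpa using h

/-- No Lipschitz estimate is needed: `h_eq` determines `h (lam t)` from the initial value, and `h`
is injective. -/
theorem IsSolution.eqOn {R : D.Mom} {T : ℝ} {lam mu : ℝ → D.dualInt}
    (hl : D.IsSolution R (Ico 0 T) lam) (hm : D.IsSolution R (Ico 0 T) mu) (h0 : lam 0 = mu 0) :
    EqOn lam mu (Ico 0 T) := by
  intro t ht
  have h1 := hl.h_eq D ht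
  rw [h0, ← hm.h_eq D ht] at h1
  exact D.h_injective (sub_left_injective (smul_right_injective _ (Real.exp_pos t).ne' h1))

/-- The path of the moments along the solution of the differential equation. -/
def momentPath (R R₀ : D.Mom) (t : ℝ) : D.Mom := R + Real.exp (-t) • (R₀ - R)

theorem momentPath_zero (R R₀ : D.Mom) : D.momentPath R R₀ 0 = R₀ := by
  simp [momentPath]

theorem hasDerivAt_momentPath (R R₀ : D.Mom) (t : ℝ) :
    HasDerivAt (D.momentPath R R₀) (R - D.momentPath R R₀ t) t := by
  have h1 := ((Real.hasDerivAt_exp (-t)).comp t (hasDerivAt_neg t)).smul_const (R₀ - R)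
  have h2 := h1.const_add R
  refine h2.congr_deriv ?_
  simp [momentPath]

theorem continuous_momentPath (R R₀ : D.Mom) : Continuous (D.momentPath R R₀) :=
  continuous_iff_continuousAt.2 fun t => (D.hasDerivAt_momentPath R R₀ t).continuousAt

theorem tendsto_momentPath (R R₀ : D.Mom) : Tendsto (D.momentPath R R₀) atTop (𝓝 R) := by
  have h1 := (Real.tendsto_exp_neg_atTop_nhds_zero.smul_const (R₀ - R)).const_add R
  rw [zero_smul, add_zero] at h1
  exact h1

/-- The point is a convex combination of `R` and `R₀`, with weight `exp (-t)` on `R₀`. -/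
theorem momentPath_mem {C : Set D.Mom} (hC : Convex ℝ C) {R R₀ : D.Mom} (hR : R ∈ C)
    (hR₀ : R₀ ∈ C) {t : ℝ} (ht : 0 ≤ t) : D.momentPath R R₀ t ∈ C :=
  hC.add_smul_sub_mem hR hR₀ ⟨(Real.exp_pos _).le, Real.exp_le_one_iff.2 (by linarith)⟩

theorem momentPath_mem_range_h (hne : D.dualInt.Nonempty) {R : D.Mom} (hR : R ∈ interior D.K)
    (lam₀ : D.dualInt) {t : ℝ} (ht : 0 ≤ t) : D.momentPath R (D.h lam₀) t ∈ range D.h := by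
  have h₀ : D.h lam₀ ∈ interior D.K := D.range_h_subset_interior_K (mem_range_self lam₀)
  have hC : Convex ℝ (interior D.K) := D.convex_K.interior
  rw [D.range_h_eq_interior_K hne]
  exact D.momentPath_mem hC hR h₀ ht

/-- The curve in the dual cone with the given moment path. -/
def flow (R : D.Mom) (lam₀ : D.dualInt) (t : ℝ) : D.dualInt :=
  haveI : Nonempty D.dualInt := ⟨lam₀⟩
  -- Where the path has left `range h` this is an arbitrary value; the flow is only used before
  -- that.
  Function.invFun D.h (D.momentPath R (D.h lam₀) t)

theorem flow_zero (R : D.Mom) (lam₀ : D.dualInt) : D.flow R lam₀ 0 = lam₀ := by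
  have : Nonempty D.dualInt := ⟨lam₀⟩
  rw [flow, momentPath_zero, Function.leftInverse_invFun D.h_injective]

theorem h_flow {R : D.Mom} {lam₀ : D.dualInt} {t : ℝ}
    (ht : D.momentPath R (D.h lam₀) t ∈ range D.h) :
    D.h (D.flow R lam₀ t) = D.momentPath R (D.h lam₀) t :=
  haveI : Nonempty D.dualInt := ⟨lam₀⟩
  Function.invFun_eq ht

/-- Chain rule: the derivative of the inverse of `h` is `(∇h)⁻¹`, applied to the path's velocity `R
- h (flow)`. -/
theorem hasDerivAt_flow {R : D.Mom} {lam₀ : D.dualInt} {t : ℝ}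
    (ht : D.momentPath R (D.h lam₀) t ∈ range D.h) :
    HasDerivAt (fun s => (D.flow R lam₀ s : D.Mom)) (D.vectorField R (D.flow R lam₀ t)) t := by
  have : Nonempty D.dualInt := ⟨lam₀⟩
  obtain ⟨G', hG, hG'⟩ := D.hasFDerivAt_invFun_h (D.flow R lam₀ t)
  rw [D.h_flow ht] at hG
  have h1 := hG.comp_hasDerivAt t (D.hasDerivAt_momentPath R (D.h lam₀) t)
  rw [hG', ← D.h_flow ht] at h1
  exact h1

theorem tendsto_flow {R : D.Mom} {lam₀ lamHat : D.dualInt} (hR : D.h lamHat = R) :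
    Tendsto (fun t => (D.flow R lam₀ t : D.Mom)) atTop (𝓝 (lamHat : D.Mom)) := by
  have : Nonempty D.dualInt := ⟨lam₀⟩
  obtain ⟨G', hG, -⟩ := D.hasFDerivAt_invFun_h lamHat
  have h1 := hG.continuousAt.tendsto
  rw [Function.leftInverse_invFun D.h_injective, hR] at h1
  exact h1.comp (D.tendsto_momentPath R (D.h lam₀))

theorem sqNorm_smul (c : ℝ) (x : D.Mom) : D.sqNorm (c • x) = c ^ 2 * D.sqNorm x := by
  simp [sqNorm, reInner, sq, mul_assoc]

theorem V_flow {R : D.Mom} {lam₀ : D.dualInt} {t : ℝ}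
    (ht : D.momentPath R (D.h lam₀) t ∈ range D.h) :
    D.V R (D.flow R lam₀ t) = Real.exp (-2 * t) * D.sqNorm (R - D.h lam₀) := by
  have h1 : R - D.h (D.flow R lam₀ t) = Real.exp (-t) • (R - D.h lam₀) := by
    rw [D.h_flow ht, momentPath, sub_add_cancel_left, ← smul_neg, neg_sub]
  have h2 : Real.exp (-2 * t) = Real.exp (-t) * Real.exp (-t) := by
    rw [← Real.exp_add]
    ring_nf
  rw [V, h1, sqNorm_smul, h2, sq]

theorem hasDerivWithinAt_V_flow {R : D.Mom} {lam₀ : D.dualInt}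
    (hp : ∀ t ∈ Ici (0 : ℝ), D.momentPath R (D.h lam₀) t ∈ range D.h) {t : ℝ} (ht : 0 ≤ t) :
    HasDerivWithinAt (fun s => D.V R (D.flow R lam₀ s)) (-2 * D.V R (D.flow R lam₀ t))
      (Ici 0) t := by
  have h1 : HasDerivAt (fun s : ℝ => Real.exp (-2 * s) * D.sqNorm (R - D.h lam₀))
      (Real.exp (-2 * t) * (-2 * 1) * D.sqNorm (R - D.h lam₀)) t :=
    (((hasDerivAt_id t).const_mul (-2)).exp).mul_const _
  have h2 := h1.hasDerivWithinAt (s := Ici 0)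
  have h3 := h2.congr (fun s hs => D.V_flow (hp s hs)) (D.V_flow (hp t ht))
  refine h3.congr_deriv ?_
  rw [D.V_flow (hp t ht)]
  ring

theorem isSolution_flow {R : D.Mom} {lam₀ : D.dualInt} {I : Set ℝ}
    (hp : ∀ t ∈ I, D.momentPath R (D.h lam₀) t ∈ range D.h) :
    D.IsSolution R I (D.flow R lam₀) :=
  fun t ht => (D.hasDerivAt_flow (hp t ht)).hasDerivWithinAt

theorem flow_converges (hne : D.dualInt.Nonempty) {R : D.Mom} (hR : R ∈ interior D.K)
    {lamHat : D.dualInt} (hlam : D.h lamHat = R) (lam₀ : D.dualInt) :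
    D.IsSolution R (Ici 0) (D.flow R lam₀) ∧
      Tendsto (fun t => (D.flow R lam₀ t : D.Mom)) atTop (𝓝 (lamHat : D.Mom)) ∧
      ∀ t ∈ Ici (0 : ℝ), HasDerivWithinAt (fun s => D.V R (D.flow R lam₀ s))
        (-2 * D.V R (D.flow R lam₀ t)) (Ici 0) t := by
  have hp : ∀ t ∈ Ici (0 : ℝ), D.momentPath R (D.h lam₀) t ∈ range D.h :=
    fun _ ht => D.momentPath_mem_range_h hne hR lam₀ ht
  exact ⟨D.isSolution_flow hp, D.tendsto_flow hlam, fun t ht => D.hasDerivWithinAt_V_flow hp ht⟩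

/-- In both cases `h` along the flow converges to a value outside `range h`: to `R` itself if the
path never leaves the range, and to the first exit point otherwise. -/
theorem flow_diverges (hne : D.dualInt.Nonempty) {R : D.Mom} (hR : R ∉ interior D.K)
    (lam₀ : D.dualInt) :
    (∃ T : ℝ, 0 < T ∧ D.IsSolution R (Ico 0 T) (D.flow R lam₀) ∧
        Tendsto (fun t => D.sqNorm (D.flow R lam₀ t : D.Mom)) (𝓝[<] T) atTop) ∨
      (D.IsSolution R (Ici 0) (D.flow R lam₀) ∧
        Tendsto (fun t => D.sqNorm (D.flow R lam₀ t : D.Mom)) atTop atTop) := by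
  rw [← D.range_h_eq_interior_K hne] at hR
  have hc := D.continuous_momentPath R (D.h lam₀)
  by_cases hp : ∀ t ∈ Ici (0 : ℝ), D.momentPath R (D.h lam₀) t ∈ range D.h
  · refine Or.inr ⟨D.isSolution_flow hp, ?_⟩
    refine D.tendsto_sqNorm_atTop ((D.tendsto_momentPath R (D.h lam₀)).congr' ?_) hR
    filter_upwards [Ici_mem_atTop (0 : ℝ)] with t ht using (D.h_flow (hp t ht)).symm
  -- The set `A` of exit times is closed because `range h` is open, so `sInf A` is itself an exit
  -- time; it is positive because the path starts at `h lam₀`.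
  · set A : Set ℝ := Ici 0 ∩ {t | D.momentPath R (D.h lam₀) t ∉ range D.h} with hA
    have hAc : IsClosed A :=
      isClosed_Ici.inter (D.isOpen_range_h.isClosed_compl.preimage hc)
    have hAne : A.Nonempty := by
      push Not at hp
      exact hp
    have hAb : BddBelow A := ⟨0, fun t ht => ht.1⟩
    have hT := hAc.csInf_mem hAne hAb
    have hlt : ∀ t ∈ Ico 0 (sInf A), D.momentPath R (D.h lam₀) t ∈ range D.h := by
      intro t ht
      by_contra hcon
      exact notMem_of_lt_csInf ht.2 hAb ⟨ht.1, hcon⟩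
    have hpos : 0 < sInf A := by
      refine lt_of_le_of_ne hT.1 fun h0 => hT.2 ?_
      rw [← h0, momentPath_zero]
      exact ⟨lam₀, rfl⟩
    refine Or.inl ⟨sInf A, hpos, D.isSolution_flow hlt, ?_⟩
    refine D.tendsto_sqNorm_atTop ((hc.continuousWithinAt (s := Iio (sInf A))).tendsto.congr' ?_)
      hT.2
    filter_upwards [Ico_mem_nhdsLT hpos] with t ht using (D.h_flow (hlt t ht)).symm

end

end MomentKernel

end

theorem theorem4 {m nl nr : ℕ} (D : MomentKernel m nl nr) (hK : D.dualInt.Nonempty) :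
    -- `gradH` is the derivative of `h` along all differentiable curves, and it is invertible
    (∀ (lam : ℝ → D.dualInt) (v : D.Mom) (t : ℝ),
      HasDerivAt (fun s => (lam s : D.Mom)) v t →
        HasDerivAt (fun s => D.h (lam s)) (D.gradH (lam t) v) t) ∧
    (∀ lam : D.dualInt, IsUnit (D.gradH lam)) ∧
    -- solutions of the initial value problems are unique
    (∀ (R : D.Mom) (T : ℝ) (lam mu : ℝ → D.dualInt),
      D.IsSolution R (Ico 0 T) lam → D.IsSolution R (Ico 0 T) mu → lam 0 = mu 0 →
        EqOn lam mu (Ico 0 T)) ∧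
    -- the case of an interior moment
    (∀ R ∈ interior D.K, ∃ lamHat : D.dualInt,
      D.IsMinimizer R (D.ratDensity lamHat) ∧
      (∀ ρ : D.HermL2, D.IsMinimizer R ρ →
        ∀ᵐ θ ∂(volume.restrict D.S), ρ.1 θ = (D.ratDensity lamHat).1 θ) ∧
      ∀ lam0 : D.dualInt, ∃ lam : ℝ → D.dualInt,
        lam 0 = lam0 ∧
        D.IsSolution R (Ici 0) lam ∧
        Tendsto (fun t => (lam t : D.Mom)) atTop (𝓝 (lamHat : D.Mom)) ∧
        ∀ t ∈ Ici (0 : ℝ),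
          HasDerivWithinAt (fun s => D.V R (lam s)) (-2 * D.V R (lam t)) (Ici 0) t) ∧
    -- the case of a moment that is not interior: the norm of the solution tends to infinity,
    -- either in finite time or as time goes to infinity
    (∀ R ∉ interior D.K, ∀ lam0 : D.dualInt, ∃ lam : ℝ → D.dualInt,
      lam 0 = lam0 ∧
      ((∃ T : ℝ, 0 < T ∧ D.IsSolution R (Ico 0 T) lam ∧
          Tendsto (fun t => D.sqNorm (lam t : D.Mom)) (𝓝[<] T) atTop) ∨
        (D.IsSolution R (Ici 0) lam ∧
          Tendsto (fun t => D.sqNorm (lam t : D.Mom)) atTop atTop))) := by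
  have hint : ∀ R ∈ interior D.K, ∃ lamHat : D.dualInt, D.h lamHat = R := fun R hR => by
    rwa [← D.range_h_eq_interior_K hK] at hR
  refine ⟨fun _ _ _ hl => D.hasDerivAt_h hl, D.isUnit_gradH,
    fun R T lam mu hl hm h0 => hl.eqOn D hm h0, ?_,
    fun R hR lam0 => ⟨D.flow R lam0, D.flow_zero R lam0, D.flow_diverges hK hR lam0⟩⟩
  intro R hR
  obtain ⟨lamHat, hlam⟩ := hint R hR
  refine ⟨lamHat, ?_, fun ρ hρ => ?_, fun lam0 =>
    ⟨D.flow R lam0, D.flow_zero R lam0, D.flow_converges hK hR hlam lam0⟩⟩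
  · rw [← hlam]
    exact D.isMinimizer_ratDensity lamHat
  · rw [← hlam] at hρ
    exact D.ae_eq_of_isMinimizer hρ
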